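/- Let $A\in\mathbb R^{n\times n}$, $B\in\mathbb R^{n\times m}$, $C\in\mathbb R^{p\times n}$, $X_0\in\mathbb R^{n\times n_0}$, where all eigenvalues of $A$ have negative real part and $(A,B,C)$ is controllable and observable. Let $y$ be the output of $$\dot x=Ax+Bu,\quad x(0)=x_0=X_0z_0,\quad y=Cx\qquad (t\ge 0),$$ with $z_0\in\mathbb R^{n_0}$ and $u\in L_2([0,\infty);\mathbb R^m)$. *Balanced truncation* of an asymptotically stable, controllable and observable system $(A,G,C)$ to order $r\le n$: let $P,Q$ be the positive definite solutions of $AP+PA^T+GG^T=0$ and $A^TQ+QA+C^TC=0$, factor $P=UU^T$, $Q=LL^T$, take a singular value decomposition $U^TL=Z\,\mathrm{diag}(s_1,\dots,s_n)\,\Psi^T$ with $s_1\ge\dots\ge s_n$ (the Hankel singular values), assume $s_r>s_{r+1}$ if $0<r<n$, and set $V=UZ_r\Sigma_r^{-1/2}$, $W=L\Psi_r\Sigma_r^{-1/2}$, where $Z_r,\Psi_r$ are the leading $r$ columns of $Z,\Psi$ and $\Sigma_r=\mathrm{diag}(s_1,\dots,s_r)$. The reduced model is $(W^TAV,W^TG,CV)$.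 Apply balanced truncation to the input-to-output map $(A,B,C)$, to order $r_u$, with Hankel singular values $\sigma_i$ and projection matrices $V_u,W_u$; and, assuming that $(A,X_0)$ is controllable too, to the initial-condition-to-output map $(A,X_0,C)$, to order $r_{x_0}$, with Hankel singular values $\theta_i$ and projection matrices $V_x,W_x$. Let $\tilde y_u$ be the output of the first reduced model for the input $u$ and zero initial state, let $\tilde y_{x_0}$ be the output of the second reduced model for zero input and initial state $W_x^TX_0z_0$, and let $\tilde y=\tilde y_u+\tilde y_{x_0}$. Let $(\bar A,\bar B,\bar C)$ be a fully balanced realization of $(A,X_0,C)$, that is, one obtained by an invertible change of state coordinates for which both Gramians equal $\Theta=\mathrm{diag}(\theta_1,\dots,\theta_n)$, $\theta_1\ge\dots\ge\theta_n$. Let $\bar Y\in\mathbb R^{n\times r_{x_0}}$ solve the Sylvester equation $\bar A^T\bar Y+\bar Y\bar A_{11}+\bar C^T\bar C_1=0$, where all matrices are partitioned into the first $r_{x_0}$ and the last $n-r_{x_0}$ state indices, and put $T=\bar B_2\bar B_2^T+2\bar Y_2\bar A_{12}$ and $\Theta_2=\mathrm{diag}(\theta_{r_{x_0}+1},\dots,\theta_n)$.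 Then $\operatorname{trace}[T\Theta_2]\ge 0$, $y-\tilde y\in L_2([0,\infty);\mathbb R^p)$, and $$\|y-\tilde y\|_{L_2}\le\Big(2\sum_{i=r_u+1}^n\sigma_i\Big)\|u\|_{L_2}+\sqrt{\operatorname{trace}[T\Theta_2]}\;\|z_0\|_2 .$$ -/

import Mathlib

open MeasureTheory

/-- The coefficients of a continuous-time linear time-invariant system
`x' = A x + B u`, `y = C x` with `n` states, `m` inputs and `p` outputs. -/
structure LTISystem (n m p : ℕ) where
  /-- state matrix -/
  A : Matrix (Fin n) (Fin n) ℝ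
  /-- input matrix -/
  B : Matrix (Fin n) (Fin m) ℝ
  /-- output matrix -/
  C : Matrix (Fin p) (Fin n) ℝ

namespace LTISystem

variable {n m p : ℕ}

/-- `x` is the state trajectory on `[0, ∞)` for the input `u` and the initial state `x₀`.
Inputs are merely locally integrable, so the differential equation is understood in the sense of
Carathéodory: `x t = x₀ + ∫₀ᵗ (A x + B u)` for all `t ≥ 0`. -/
structure IsTrajectory (S : LTISystem n m p) (u : ℝ → Fin m → ℝ) (x₀ : Fin n → ℝ)
    (x : ℝ → Fin n → ℝ) : Prop where
  integrable : ∀ t : ℝ, 0 ≤ t →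
    IntervalIntegrable (fun s => S.A.mulVec (x s) + S.B.mulVec (u s)) volume 0 t
  eq_integral : ∀ t : ℝ, 0 ≤ t →
    x t = x₀ + ∫ s in (0 : ℝ)..t, (S.A.mulVec (x s) + S.B.mulVec (u s))

/-- `y` is the output on `[0, ∞)` for the input `u` and the initial state `x₀`. -/
def IsOutput (S : LTISystem n m p) (u : ℝ → Fin m → ℝ) (x₀ : Fin n → ℝ)
    (y : ℝ → Fin p → ℝ) : Prop :=
  ∃ x : ℝ → Fin n → ℝ, S.IsTrajectory u x₀ x ∧ ∀ t : ℝ, 0 ≤ t → y t = S.C.mulVec (x t)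

/-- Asymptotic stability: all (complex) eigenvalues of `A` have negative real part. -/
def IsStable (S : LTISystem n m p) : Prop :=
  ∀ μ ∈ spectrum ℂ (S.A.map (algebraMap ℝ ℂ)), μ.re < 0

/-- Controllability: `rank [sI - A, B] = n` for all complex `s`. -/
def IsControllable (S : LTISystem n m p) : Prop :=
  ∀ s : ℂ, (Matrix.fromCols
    (s • (1 : Matrix (Fin n) (Fin n) ℂ) - S.A.map (algebraMap ℝ ℂ))
    (S.B.map (algebraMap ℝ ℂ))).rank = n

/-- Observability: `rank [sI - Aᵀ, Cᵀ] = n` for all complex `s`. -/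
def IsObservable (S : LTISystem n m p) : Prop :=
  ∀ s : ℂ, (Matrix.fromCols
    (s • (1 : Matrix (Fin n) (Fin n) ℂ) - S.A.transpose.map (algebraMap ℝ ℂ))
    (S.C.transpose.map (algebraMap ℝ ℂ))).rank = n

/-- `P` is the reachability Gramian: the positive definite solution of `A P + P Aᵀ + B Bᵀ = 0`. -/
def IsReachabilityGramian (S : LTISystem n m p) (P : Matrix (Fin n) (Fin n) ℝ) : Prop :=
  P.PosDef ∧ S.A * P + P * S.A.transpose + S.B * S.B.transpose = 0

/-- `Q` is the observability Gramian: the positive definite solution of `Aᵀ Q + Q A + Cᵀ C = 0`. -/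
def IsObservabilityGramian (S : LTISystem n m p) (Q : Matrix (Fin n) (Fin n) ℝ) : Prop :=
  Q.PosDef ∧ S.A.transpose * Q + Q * S.A + S.C.transpose * S.C = 0

/-- The Petrov-Galerkin projection `(Wᵀ A V, Wᵀ B, C V)`. -/
def project {r : ℕ} (S : LTISystem n m p) (V W : Matrix (Fin n) (Fin r) ℝ) :
    LTISystem r m p where
  A := W.transpose * S.A * V
  B := W.transpose * S.B
  C := S.C * V

/-- Square-root balanced truncation to order `r ≤ n`.  From factors `P = U Uᵀ`, `Q = L Lᵀ` of the
Gramians and a singular value decomposition `Uᵀ L = Z diag(σ) Yᵀ` with decreasing `σ` (the Hankel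
singular values, numbered from `0`) and with a gap `σ_{r-1} > σ_r` between the retained and the
truncated values, it forms `V = U Z_r Σ_r^{-1/2}` and `W = L Y_r Σ_r^{-1/2}`, where `Z_r`, `Y_r` are
the leading `r` columns.  The reduced system is then `S.project V W`. -/
def IsBalancedTruncation (S : LTISystem n m p) {r : ℕ} (hr : r ≤ n) (σ : Fin n → ℝ)
    (V W : Matrix (Fin n) (Fin r) ℝ) : Prop :=
  ∃ P Q U L Z Y : Matrix (Fin n) (Fin n) ℝ,
    S.IsReachabilityGramian P ∧ S.IsObservabilityGramian Q ∧
    P = U * U.transpose ∧ Q = L * L.transpose ∧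
    Z ∈ Matrix.orthogonalGroup (Fin n) ℝ ∧ Y ∈ Matrix.orthogonalGroup (Fin n) ℝ ∧
    (∀ i, 0 ≤ σ i) ∧ Antitone σ ∧
    U.transpose * L = Z * Matrix.diagonal σ * Y.transpose ∧
    (∀ i j : Fin n, i.val < r → r ≤ j.val → σ j < σ i) ∧
    V = U * Z.submatrix id (Fin.castLE hr) *
      Matrix.diagonal (fun i : Fin r => (Real.sqrt (σ (Fin.castLE hr i)))⁻¹) ∧
    W = L * Y.submatrix id (Fin.castLE hr) *
      Matrix.diagonal (fun i : Fin r => (Real.sqrt (σ (Fin.castLE hr i)))⁻¹)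

/-- `T` is a fully balanced realization of `S`: it arises from `S` by an invertible change of state
coordinates, and both of its Gramians equal `diag(θ)` with decreasing `θ` (the Hankel singular
values). -/
def IsBalancedRealization (S T : LTISystem n m p) (θ : Fin n → ℝ) : Prop :=
  (∃ R : Matrix (Fin n) (Fin n) ℝ, IsUnit R.det ∧
    T.A = R⁻¹ * S.A * R ∧ T.B = R⁻¹ * S.B ∧ T.C = S.C * R) ∧
  Antitone θ ∧
  T.IsReachabilityGramian (Matrix.diagonal θ) ∧
  T.IsObservabilityGramian (Matrix.diagonal θ)

end LTISystem

/-- The embedding of the trailing `n - r` indices. -/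
def tailIdx {n r : ℕ} (hr : r ≤ n) (i : Fin (n - r)) : Fin n :=
  ⟨r + i.val, by omega⟩

/-- Membership in `L₂([0, ∞); ℝᵏ)`. (Which norm on `ℝᵏ` is used does not matter here.) -/
def MemL2 {k : ℕ} (f : ℝ → Fin k → ℝ) : Prop :=
  MemLp f 2 (volume.restrict (Set.Ici (0 : ℝ)))

/-- The norm `(∫₀^∞ f(t)ᵀ f(t) dt)^{1/2}` of `L₂([0, ∞); ℝᵏ)`. -/
noncomputable def normL2 {k : ℕ} (f : ℝ → Fin k → ℝ) : ℝ :=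
  Real.sqrt (∫ t in Set.Ici (0 : ℝ), dotProduct (f t) (f t))

/-- The sum `∑_{i > r} σ_i` (in numbering from `1`) of the truncated Hankel singular values. -/
def truncatedSum {n : ℕ} (r : ℕ) (σ : Fin n → ℝ) : ℝ :=
  ∑ i : Fin n with r ≤ i.val, σ i

/-- `trace [(B₂ B₂ᵀ + 2 Y₂ A₁₂) Θ₂]` for the partition of a system (of order `n`), of the matrix
`Y` and of `diag(θ)` into the leading `r` and the trailing `n - r` indices. -/
def traceTTheta {n m p r : ℕ} (hr : r ≤ n) (S : LTISystem n m p) (θ : Fin n → ℝ)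
    (Y : Matrix (Fin n) (Fin r) ℝ) : ℝ :=
  let B₂ : Matrix (Fin (n - r)) (Fin m) ℝ := S.B.submatrix (tailIdx hr) id
  let A₁₂ : Matrix (Fin r) (Fin (n - r)) ℝ := S.A.submatrix (Fin.castLE hr) (tailIdx hr)
  let Y₂ : Matrix (Fin (n - r)) (Fin r) ℝ := Y.submatrix (tailIdx hr) id
  let Θ₂ : Matrix (Fin (n - r)) (Fin (n - r)) ℝ := Matrix.diagonal (fun i => θ (tailIdx hr i))
  Matrix.trace ((B₂ * B₂.transpose + (2 : ℝ) • (Y₂ * A₁₂)) * Θ₂)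

/-- The Sylvester equation `Aᵀ Y + Y A₁₁ + Cᵀ C₁ = 0`, with `A₁₁` the leading `r × r` block of `A`
and `C₁` the leading `r` columns of `C`. -/
def SolvesSylvester {n m p r : ℕ} (hr : r ≤ n) (S : LTISystem n m p)
    (Y : Matrix (Fin n) (Fin r) ℝ) : Prop :=
  S.A.transpose * Y + Y * S.A.submatrix (Fin.castLE hr) (Fin.castLE hr) +
    S.C.transpose * S.C.submatrix id (Fin.castLE hr) = 0

/-!
# A-priori error bound for balanced truncation with inhomogeneous initial states

By linearity, the output error is the sum of the error in the response to the input and the error in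
the response to the initial state; each is bounded by a quadratic storage function.

*Input.* In balanced coordinates, with both Gramians equal to `Σ = diag(σ)`, the states are removed
one at a time. If `x` and `z` are the states (with the same input) before and after removing the state
`k`, and `e = x - z`, `s = x + z`, then
`d/dt (eᵀ Σ e + σ_k² sᵀ Σ⁻¹ s) ≤ 4 σ_k² |u|² - |C e|²`, because the contributions of the removed state to
the two summands cancel (`dissipation_step`). Integration bounds the one-step error by
`2 σ_k ‖u‖`, and the triangle inequality gives `hasL2Bound_project`. No stability of the intermediate
systems is needed, so repeated singular values cause no trouble.

*Initial state.* For the balanced realization, with state `x`, and its leading subsystem, with state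
`ξ`, the function `V = xᵀ Θ x - 2 xᵀ Y ξ + ξᵀ Θ₁ ξ` satisfies `d/dt V = - |error|²` by the two Lyapunov
equations and the Sylvester equation. As `x` tends to zero, completing the square in `ξ` gives
`liminf V ≥ 0`, so the energy of the error is at most `V(0) = zᵀ N z` (`energy_le_errorGramian`). The
matrix `N` therefore has a nonnegative quadratic form, which is at most `trace N * |z|²`, and
`trace N = trace (T Θ₂)` follows from the equations for the Gramians and for `Y`
(`trace_errorGramian`).

*Coordinates.* The square-root method yields the leading columns of a balancing transformation. Two
balancing transformations of a stable system differ by a matrix that commutes with `Θ²`, since the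
Gramians are unique (`lyapunov_unique`); it is block diagonal at a gap of the singular values
(`IsBalancing.mul_incl_eq`), and its leading block maps one reduced model to the other.
-/

namespace BalancedTruncation

open Filter Topology Matrix

/-! ### Primitives on the half line -/

section Primitive

variable {E F : Type*} [NormedAddCommGroup E] [NormedSpace ℝ E]
  [NormedAddCommGroup F] [NormedSpace ℝ F]

/-- On `[0, ∞)`, `x` is the primitive of the locally integrable function `v` with `x 0 = x₀`;
equivalently, `x` is locally absolutely continuous with almost everywhere derivative `v`. -/
structure IsPrimitive (x v : ℝ → E) (x₀ : E) : Prop where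
  integrable : ∀ t : ℝ, 0 ≤ t → IntervalIntegrable v volume 0 t
  eq_integral : ∀ t : ℝ, 0 ≤ t → x t = x₀ + ∫ s in (0 : ℝ)..t, v s

namespace IsPrimitive

variable {x v x' v' : ℝ → E} {x₀ x₀' : E}

theorem congr (h : IsPrimitive x v x₀) (hx : ∀ t, 0 ≤ t → x' t = x t)
    (hv : ∀ t, 0 ≤ t → v' t = v t) (h₀ : x₀' = x₀) : IsPrimitive x' v' x₀' := by
  have hvv (t : ℝ) (ht : 0 ≤ t) : Set.EqOn v v' (Set.uIoc 0 t) := by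
    intro s hs
    rw [Set.uIoc_of_le ht] at hs
    exact (hv s hs.1.le).symm
  refine ⟨fun t ht => (h.integrable t ht).congr (hvv t ht), fun t ht => ?_⟩
  rw [hx t ht, h.eq_integral t ht, h₀,
      intervalIntegral.integral_congr_ae (.of_forall fun s hs => hvv t ht hs)]

theorem add (h : IsPrimitive x v x₀) (h' : IsPrimitive x' v' x₀') :
    IsPrimitive (fun t => x t + x' t) (fun t => v t + v' t) (x₀ + x₀') := by
  refine ⟨fun t ht => (h.integrable t ht).add (h'.integrable t ht), fun t ht => ?_⟩
  rw [h.eq_integral t ht, h'.eq_integral t ht,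
    intervalIntegral.integral_add (h.integrable t ht) (h'.integrable t ht)]
  abel

theorem map [CompleteSpace E] [CompleteSpace F] (h : IsPrimitive x v x₀) (L : E →L[ℝ] F) :
    IsPrimitive (fun t => L (x t)) (fun t => L (v t)) (L x₀) := by
  refine ⟨fun t ht => ?_, fun t ht => ?_⟩
  · have := h.integrable t ht
    rw [intervalIntegrable_iff] at this ⊢
    exact L.integrable_comp this
  · rw [h.eq_integral t ht, map_add, L.intervalIntegral_comp_comm (h.integrable t ht)]

theorem sub [CompleteSpace E] (h : IsPrimitive x v x₀) (h' : IsPrimitive x' v' x₀') :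
    IsPrimitive (fun t => x t - x' t) (fun t => v t - v' t) (x₀ - x₀') := by
  simpa [sub_eq_add_neg] using h.add (h'.map (-ContinuousLinearMap.id ℝ E))

theorem sum {ι : Type*} (s : Finset ι) {x v : ι → ℝ → E} {x₀ : ι → E}
    (h : ∀ i, IsPrimitive (x i) (v i) (x₀ i)) :
    IsPrimitive (fun t => ∑ i ∈ s, x i t) (fun t => ∑ i ∈ s, v i t) (∑ i ∈ s, x₀ i) := by
  classical
  induction s using Finset.induction_on with
  | empty => exact ⟨fun t _ => by simp, fun t _ => by simp⟩
  | insert i s hi ih => simpa [Finset.sum_insert hi] using (h i).add ih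

theorem continuousOn (h : IsPrimitive x v x₀) {T : ℝ} (hT : 0 ≤ T) :
    ContinuousOn x (Set.uIcc 0 T) := by
  have h1 : ContinuousOn (fun t => x₀ + ∫ s in (0 : ℝ)..t, v s) (Set.uIcc 0 T) :=
    continuousOn_const.add (intervalIntegral.continuousOn_primitive_interval
      (by rw [Set.uIcc_of_le hT]
          exact (intervalIntegrable_iff_integrableOn_Icc_of_le hT).1 (h.integrable T hT)))
  refine h1.congr fun t ht => h.eq_integral t ?_
  rw [Set.uIcc_of_le hT] at ht
  exact ht.1

theorem continuousOn_Ici (h : IsPrimitive x v x₀) : ContinuousOn x (Set.Ici 0) := by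
  intro t ht
  have h1 := h.continuousOn (T := t + 1) (by have : 0 ≤ t := ht; linarith)
  rw [Set.uIcc_of_le (by have : 0 ≤ t := ht; linarith)] at h1
  have h2 := h1 t ⟨ht, by linarith⟩
  refine h2.mono_of_mem_nhdsWithin ?_
  rw [← Set.Ici_inter_Iic]
  exact inter_mem_nhdsWithin _ (Iic_mem_nhds (by linarith))

/-- The Leibniz rule for absolutely continuous functions. -/
theorem mul {f f' g g' : ℝ → ℝ} {a b : ℝ} (hf : IsPrimitive f f' a) (hg : IsPrimitive g g' b) :
    IsPrimitive (fun t => f t * g t) (fun t => f' t * g t + f t * g' t) (a * b) := by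
  have hint (t : ℝ) (ht : 0 ≤ t) :
      IntervalIntegrable (fun t => f' t * g t + f t * g' t) volume 0 t :=
    ((hf.integrable t ht).mul_continuousOn (hg.continuousOn ht)).add
      ((hg.integrable t ht).continuousOn_mul (hf.continuousOn ht))
  refine ⟨hint, fun t ht => ?_⟩
  have h0 : (0 : ℝ) ∈ Set.uIcc 0 t := by simp
  have ac {f f' : ℝ → ℝ} (a : ℝ) (hf : IsPrimitive f f' a) :
      AbsolutelyContinuousOnInterval (fun t => a + ∫ s in (0 : ℝ)..t, f' s) 0 t :=
    (LipschitzWith.const a).lipschitzOnWith.absolutelyContinuousOnInterval.fun_add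
      ((hf.integrable t ht).absolutelyContinuousOnInterval_intervalIntegral h0)
  have key := (ac a hf).integral_deriv_mul_eq_sub (ac b hg)
  simp only [intervalIntegral.integral_same, add_zero] at key
  rw [hf.eq_integral t ht, hg.eq_integral t ht, eq_comm, ← eq_sub_iff_add_eq', ← key]
  apply intervalIntegral.integral_congr_ae
  filter_upwards [(hf.integrable t ht).ae_hasDerivAt_integral,
    (hg.integrable t ht).ae_hasDerivAt_integral] with s h1 h2 hs
  have hs' : 0 ≤ s := by
    rw [Set.uIoc_of_le ht] at hs
    exact hs.1.le
  have hs := Set.uIoc_subset_uIcc hs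
  rw [((h1 hs 0 h0).const_add a).deriv, ((h2 hs 0 h0).const_add b).deriv,
    hf.eq_integral s hs', hg.eq_integral s hs']

theorem apply {ι : Type*} [Fintype ι] {x v : ℝ → ι → ℝ} {x₀ : ι → ℝ} (h : IsPrimitive x v x₀)
    (i : ι) : IsPrimitive (fun t => x t i) (fun t => v t i) (x₀ i) :=
  h.map (ContinuousLinearMap.proj (R := ℝ) (φ := fun _ : ι => ℝ) i)

theorem mulVec {ι κ : Type*} [Fintype ι] [Fintype κ] {x v : ℝ → ι → ℝ} {x₀ : ι → ℝ}
    (h : IsPrimitive x v x₀) (M : Matrix κ ι ℝ) :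
    IsPrimitive (fun t => M *ᵥ x t) (fun t => M *ᵥ v t) (M *ᵥ x₀) :=
  h.map (LinearMap.toContinuousLinearMap M.mulVecLin)

theorem dotProduct {ι : Type*} [Fintype ι] {x v y w : ℝ → ι → ℝ} {x₀ y₀ : ι → ℝ}
    (hx : IsPrimitive x v x₀) (hy : IsPrimitive y w y₀) :
    IsPrimitive (fun t => x t ⬝ᵥ y t) (fun t => v t ⬝ᵥ y t + x t ⬝ᵥ w t) (x₀ ⬝ᵥ y₀) := by
  refine (sum Finset.univ fun i => (hx.apply i).mul (hy.apply i)).congr (fun t _ => rfl)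
    (fun t _ => ?_) rfl
  simp [_root_.dotProduct, Finset.sum_add_distrib]

/-- A primitive grows at most by the integral of an upper bound of its derivative. -/
theorem le_add_integral {f f' g : ℝ → ℝ} {a T : ℝ} (h : IsPrimitive f f' a) (hT : 0 ≤ T)
    (hg : IntervalIntegrable g volume 0 T) (hle : ∀ t, 0 ≤ t → f' t ≤ g t) :
    f T ≤ a + ∫ t in (0 : ℝ)..T, g t := by
  rw [h.eq_integral T hT]
  gcongr
  exact intervalIntegral.integral_mono_on hT (h.integrable T hT) hg fun t ht => hle t ht.1

theorem of_hasDerivAt [CompleteSpace E] (hd : ∀ t, HasDerivAt x (v t) t) (hv : Continuous v) :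
    IsPrimitive x v (x 0) := by
  refine ⟨fun t _ => hv.intervalIntegrable 0 t, fun t _ => ?_⟩
  rw [intervalIntegral.integral_eq_sub_of_hasDerivAt (fun s _ => hd s) (hv.intervalIntegrable 0 t)]
  abel

end IsPrimitive

end Primitive

/-! ### Bounds in `L₂([0, ∞))` -/

section L2

variable {k : ℕ} {f g : ℝ → Fin k → ℝ} {c d : ℝ}

/-- `f` is square integrable on `[0, ∞)` with `L₂`-norm, formed with the Euclidean norm of the
values, at most `c`. -/
def HasL2Bound (f : ℝ → Fin k → ℝ) (c : ℝ) : Prop :=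
  AEStronglyMeasurable (fun t => (WithLp.toLp 2 (f t) : EuclideanSpace ℝ (Fin k)))
    (volume.restrict (Set.Ici (0 : ℝ))) ∧
  eLpNorm (fun t => (WithLp.toLp 2 (f t) : EuclideanSpace ℝ (Fin k))) 2
    (volume.restrict (Set.Ici (0 : ℝ))) ≤ ENNReal.ofReal c

theorem norm_toLp_sq (a : Fin k → ℝ) :
    ‖(WithLp.toLp 2 a : EuclideanSpace ℝ (Fin k))‖ ^ 2 = a ⬝ᵥ a := by
  rw [EuclideanSpace.real_norm_sq_eq]
  simp [dotProduct, sq]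

theorem aestronglyMeasurable_toLp_iff {μ : Measure ℝ} :
    AEStronglyMeasurable (fun t => (WithLp.toLp 2 (f t) : EuclideanSpace ℝ (Fin k))) μ ↔
      AEStronglyMeasurable f μ := by
  constructor
  · intro h
    exact (PiLp.continuous_ofLp 2 (fun _ : Fin k => ℝ)).comp_aestronglyMeasurable h
  · intro h
    exact (PiLp.continuous_toLp 2 (fun _ : Fin k => ℝ)).comp_aestronglyMeasurable h

theorem memLp_toLp_iff {μ : Measure ℝ} :
    MemLp (fun t => (WithLp.toLp 2 (f t) : EuclideanSpace ℝ (Fin k))) 2 μ ↔ MemLp f 2 μ := by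
  constructor
  · intro h
    exact h.continuousLinearMap_comp
      (PiLp.continuousLinearEquiv 2 ℝ (fun _ : Fin k => ℝ)).toContinuousLinearMap
  · intro h
    exact h.continuousLinearMap_comp
      (PiLp.continuousLinearEquiv 2 ℝ (fun _ : Fin k => ℝ)).symm.toContinuousLinearMap

theorem _root_.MemL2.integrable_dotProduct (hf : MemL2 f) :
    Integrable (fun t => f t ⬝ᵥ f t) (volume.restrict (Set.Ici (0 : ℝ))) := by
  have h := (memLp_two_iff_integrable_sq_norm (memLp_toLp_iff.2 hf).1).1 (memLp_toLp_iff.2 hf)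
  simpa only [norm_toLp_sq] using h

theorem eLpNorm_toLp (hf : MemL2 f) :
    eLpNorm (fun t => (WithLp.toLp 2 (f t) : EuclideanSpace ℝ (Fin k))) 2
      (volume.restrict (Set.Ici (0 : ℝ))) = ENNReal.ofReal (normL2 f) := by
  rw [(memLp_toLp_iff.2 hf).eLpNorm_eq_integral_rpow_norm (by norm_num) (by norm_num)]
  congr 1
  rw [normL2, Real.sqrt_eq_rpow]
  simp [norm_toLp_sq]

namespace HasL2Bound

theorem memL2 (hf : HasL2Bound f c) : MemL2 f :=
  memLp_toLp_iff.1 ⟨hf.1, hf.2.trans_lt ENNReal.ofReal_lt_top⟩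

theorem normL2_le (hf : HasL2Bound f c) (hc : 0 ≤ c) : normL2 f ≤ c := by
  have h := hf.2
  rw [eLpNorm_toLp hf.memL2] at h
  exact (ENNReal.ofReal_le_ofReal_iff hc).1 h

theorem add (hf : HasL2Bound f c) (hg : HasL2Bound g d) (hc : 0 ≤ c) (hd : 0 ≤ d) :
    HasL2Bound (fun t => f t + g t) (c + d) := by
  refine ⟨hf.1.add hg.1, (eLpNorm_add_le hf.1 hg.1 (by norm_num)).trans ?_⟩
  rw [ENNReal.ofReal_add hc hd]
  exact add_le_add hf.2 hg.2

theorem congr (hf : HasL2Bound f c) (h : ∀ t, 0 ≤ t → g t = f t) : HasL2Bound g c := by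
  have hae : (fun t => (WithLp.toLp 2 (f t) : EuclideanSpace ℝ (Fin k)))
      =ᵐ[volume.restrict (Set.Ici (0 : ℝ))] fun t => WithLp.toLp 2 (g t) := by
    filter_upwards [ae_restrict_mem measurableSet_Ici] with t ht
    rw [h t ht]
  exact ⟨hf.1.congr hae, (eLpNorm_congr_ae hae).symm.trans_le hf.2⟩

/-- Monotone convergence: bounds of the energy on all bounded intervals give an `L₂`-bound. -/
theorem of_energy (hf : ContinuousOn f (Set.Ici 0)) (hc : 0 ≤ c)
    (h : ∀ T, 0 ≤ T → ∫ t in (0 : ℝ)..T, f t ⬝ᵥ f t ≤ c ^ 2) : HasL2Bound f c := by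
  have hm : AEStronglyMeasurable f (volume.restrict (Set.Ici 0)) :=
    hf.aestronglyMeasurable measurableSet_Ici
  have hff : ContinuousOn (fun t => f t ⬝ᵥ f t) (Set.Ici 0) := by
    have : Continuous fun a : Fin k → ℝ => a ⬝ᵥ a := by fun_prop
    exact this.comp_continuousOn hf
  have hnn (t : ℝ) : 0 ≤ f t ⬝ᵥ f t := by
    simpa using dotProduct_star_self_nonneg (f t)
  have hI : IntegrableOn (fun t => f t ⬝ᵥ f t) (Set.Ioi 0) := by
    refine integrableOn_Ioi_of_intervalIntegral_norm_bounded (l := atTop) (b := id) (c ^ 2) 0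
      (fun T => ?_) tendsto_id ?_
    · exact ((hff.mono Set.Icc_subset_Ici_self).integrableOn_Icc).mono_set Set.Ioc_subset_Icc_self
    · filter_upwards [eventually_ge_atTop 0] with T hT
      simpa [abs_of_nonneg (hnn _)] using h T hT
  have hle : ∫ t in Set.Ici (0 : ℝ), f t ⬝ᵥ f t ≤ c ^ 2 := by
    rw [integral_Ici_eq_integral_Ioi]
    refine le_of_tendsto (intervalIntegral_tendsto_integral_Ioi 0 hI tendsto_id) ?_
    filter_upwards [eventually_ge_atTop 0] with T hT
    exact h T hT
  have hmem : MemL2 f := by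
    refine memLp_toLp_iff.1 ?_
    rw [memLp_two_iff_integrable_sq_norm (aestronglyMeasurable_toLp_iff.2 hm)]
    simp only [norm_toLp_sq]
    exact (integrableOn_Ici_iff_integrableOn_Ioi (by simp)).2 hI
  refine ⟨aestronglyMeasurable_toLp_iff.2 hm, ?_⟩
  rw [eLpNorm_toLp hmem]
  exact ENNReal.ofReal_le_ofReal ((Real.sqrt_le_sqrt hle).trans_eq (Real.sqrt_sq hc))

end HasL2Bound

theorem normL2_nonneg (f : ℝ → Fin k → ℝ) : 0 ≤ normL2 f := Real.sqrt_nonneg _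

variable {T : ℝ}

theorem _root_.MemL2.intervalIntegrable_dotProduct (hf : MemL2 f) (hT : 0 ≤ T) :
    IntervalIntegrable (fun t => f t ⬝ᵥ f t) volume 0 T := by
  rw [intervalIntegrable_iff_integrableOn_Icc_of_le hT]
  exact IntegrableOn.mono_set (t := Set.Ici 0) hf.integrable_dotProduct Set.Icc_subset_Ici_self

theorem _root_.MemL2.intervalIntegrable (hf : MemL2 f) (hT : 0 ≤ T) :
    IntervalIntegrable f volume 0 T := by
  rw [intervalIntegrable_iff_integrableOn_Icc_of_le hT]
  have h : MemLp f 2 (volume.restrict (Set.Icc 0 T)) :=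
    hf.mono_measure (Measure.restrict_mono Set.Icc_subset_Ici_self le_rfl)
  exact h.integrable (by norm_num)

theorem _root_.MemL2.energy_le (hf : MemL2 f) (hT : 0 ≤ T) :
    ∫ t in (0 : ℝ)..T, f t ⬝ᵥ f t ≤ normL2 f ^ 2 := by
  have hnn (t : ℝ) : 0 ≤ f t ⬝ᵥ f t := by
    simpa using dotProduct_star_self_nonneg (f t)
  rw [normL2, Real.sq_sqrt (integral_nonneg hnn), intervalIntegral.integral_of_le hT]
  exact setIntegral_mono_set (s := Set.Ioc 0 T) hf.integrable_dotProduct (.of_forall hnn)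
    (.of_forall fun t ht => ht.1.le)

end L2

/-! ### Linear differential equations: existence and decay -/

section Exponential

variable {E : Type*} [NormedAddCommGroup E] [NormedSpace ℂ E] [CompleteSpace E]

/-- A form of `NormedSpace.exp_add_of_commute` for real and complex Banach algebras that does not ask
for a normed `ℚ`-algebra structure. -/
theorem exp_add_of_commute (𝕜 : Type*) [RCLike 𝕜] {R : Type*} [NormedRing R] [NormedAlgebra 𝕜 R]
    [CompleteSpace R] {x y : R} (h : Commute x y) :
    NormedSpace.exp (x + y) = NormedSpace.exp x * NormedSpace.exp y :=
  NormedSpace.exp_add_of_commute_of_mem_ball (𝕂 := 𝕜) h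
    ((NormedSpace.expSeries_radius_eq_top 𝕜 R).symm ▸ edist_lt_top _ _)
    ((NormedSpace.expSeries_radius_eq_top 𝕜 R).symm ▸ edist_lt_top _ _)

/-- On a generalized eigenvector the exponential series is a finite sum. -/
theorem exp_smul_apply_of_pow_eq_zero (a : E →L[ℂ] E) (v : E) (k : ℕ) (hk : (a ^ k) v = 0)
    (t : ℂ) : NormedSpace.exp (t • a) v =
      ∑ j ∈ Finset.range k, ((j.factorial : ℂ)⁻¹ * t ^ j) • (a ^ j) v := by
  have h := (NormedSpace.exp_series_hasSum_exp' (𝕂 := ℂ) (t • a)).mapL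
    (ContinuousLinearMap.apply ℂ E v)
  have h2 := hasSum_sum_of_ne_finset_zero (L := .unconditional ℕ) (s := Finset.range k)
    (f := fun j : ℕ => ((j.factorial : ℂ)⁻¹ * t ^ j) • (a ^ j) v) (fun j hj => by
      have : k ≤ j := by simpa using hj
      obtain ⟨i, rfl⟩ := Nat.exists_eq_add_of_le' this
      simp [pow_add, hk])
  refine h.unique ?_
  convert h2 using 2 with j
  simp [smul_pow, mul_smul]

theorem tendsto_exp_smul_apply_of_generalized (a : E →L[ℂ] E) (v : E) (μ : ℂ) (hμ : μ.re < 0)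
    (k : ℕ) (hk : ((a - μ • 1) ^ k) v = 0) :
    Tendsto (fun t : ℝ => NormedSpace.exp ((t : ℂ) • a) v) atTop (𝓝 0) := by
  have h (t : ℝ) : NormedSpace.exp ((t : ℂ) • a) v = ∑ j ∈ Finset.range k,
      (Complex.exp (t * μ) * ((j.factorial : ℂ)⁻¹ * t ^ j)) • ((a - μ • 1) ^ j) v := by
    have h1 : (t : ℂ) • a = ((t : ℂ) * μ) • (1 : E →L[ℂ] E) + (t : ℂ) • (a - μ • 1) := by
      rw [smul_sub, smul_smul]; abel
    have h2 : Commute (((t : ℂ) * μ) • (1 : E →L[ℂ] E)) ((t : ℂ) • (a - μ • 1)) :=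
      (Commute.one_left _).smul_left _
    have h3 : NormedSpace.exp (((t : ℂ) * μ) • (1 : E →L[ℂ] E)) =
        Complex.exp (t * μ) • (1 : E →L[ℂ] E) := by
      rw [← Algebra.algebraMap_eq_smul_one, ← NormedSpace.algebraMap_exp_comm,
        ← Complex.exp_eq_exp_ℂ, Algebra.algebraMap_eq_smul_one]
    rw [h1, exp_add_of_commute ℂ h2, h3, smul_mul_assoc, one_mul,
      _root_.smul_apply, exp_smul_apply_of_pow_eq_zero _ v k hk, Finset.smul_sum]
    simp only [smul_smul]
  simp only [h]
  rw [← Finset.sum_const_zero (s := Finset.range k)]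
  refine tendsto_finsetSum _ fun j _ => ?_
  rw [← zero_smul ℂ (((a - μ • 1) ^ j) v)]
  refine Tendsto.smul_const ?_ _
  rw [tendsto_zero_iff_norm_tendsto_zero]
  have h4 := ((Real.tendsto_pow_mul_exp_neg_atTop_nhds_zero j).comp
    (tendsto_id.const_mul_atTop (neg_pos.2 hμ))).const_mul ((j.factorial : ℝ)⁻¹ * ((-μ.re) ^ j)⁻¹)
  rw [mul_zero] at h4
  refine h4.congr' ?_
  filter_upwards [eventually_ge_atTop 0] with t ht
  have hne : (-μ.re) ^ j ≠ 0 := pow_ne_zero _ (by linarith)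
  have hexp : -(-μ.re * t) = t * μ.re := by ring
  simp only [Function.comp, id, mul_pow, hexp, norm_mul, Complex.norm_exp, norm_inv, norm_pow,
    Complex.norm_natCast, Complex.norm_real, Real.norm_eq_abs, abs_of_nonneg ht, Complex.mul_re,
    Complex.ofReal_re, Complex.ofReal_im, zero_mul, sub_zero]
  field_simp

/-- If all eigenvalues lie in the open left half plane, the flow tends to zero: the vectors whose
orbit tends to zero form a subspace, and it contains all generalized eigenvectors. -/
theorem tendsto_exp_smul_apply [FiniteDimensional ℂ E] (a : E →L[ℂ] E)
    (ha : ∀ μ : ℂ, Module.End.HasEigenvalue (a : E →ₗ[ℂ] E) μ → μ.re < 0) (v : E) :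
    Tendsto (fun t : ℝ => NormedSpace.exp ((t : ℂ) • a) v) atTop (𝓝 0) := by
  let D : Submodule ℂ E :=
    { carrier := {v | Tendsto (fun t : ℝ => NormedSpace.exp ((t : ℂ) • a) v) atTop (𝓝 0)}
      add_mem' := fun {x y} hx hy => by simpa using Tendsto.add hx hy
      zero_mem' := by simp
      smul_mem' := fun c x hx => by simpa using Tendsto.const_smul hx c }
  suffices h : D = ⊤ from (h ▸ Submodule.mem_top : v ∈ D)
  rw [eq_top_iff, ← Module.End.iSup_maxGenEigenspace_eq_top (a : E →ₗ[ℂ] E)]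
  refine iSup_le fun μ w hw => ?_
  by_cases hw0 : w = 0
  · exact hw0 ▸ D.zero_mem
  obtain ⟨k, hk⟩ := (Module.End.mem_maxGenEigenspace _ _ _).1 hw
  have hev : Module.End.HasEigenvalue (a : E →ₗ[ℂ] E) μ := by
    refine Module.End.hasEigenvalue_of_hasGenEigenvalue (k := k) ?_
    rw [Module.End.hasGenEigenvalue_iff, Submodule.ne_bot_iff]
    exact ⟨w, by rw [Module.End.mem_genEigenspace_nat]; simpa using hk, hw0⟩
  refine tendsto_exp_smul_apply_of_generalized a w μ (ha μ hev) k ?_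
  have hpow (j : ℕ) (z : E) : ((a - μ • 1) ^ j) z = (((a : E →ₗ[ℂ] E) - μ • 1) ^ j) z := by
    induction j generalizing z with
    | zero => simp
    | succ j ih => rw [pow_succ, pow_succ]; simp [ih]
  rw [hpow]
  exact hk

end Exponential

section Existence

variable {n m p : ℕ}

/-- The homogeneous equation with a stable matrix has a decaying solution for every initial state:
the real part of the complex matrix exponential. -/
theorem exists_decaying_solution (A : Matrix (Fin n) (Fin n) ℝ)
    (hA : ∀ μ ∈ spectrum ℂ (A.map (algebraMap ℝ ℂ)), μ.re < 0) (x₀ : Fin n → ℝ) :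
    ∃ x : ℝ → Fin n → ℝ, IsPrimitive x (fun t => A *ᵥ x t) x₀ ∧ Tendsto x atTop (𝓝 0) := by
  set Ac := A.map (algebraMap ℝ ℂ) with hAc
  let a : (Fin n → ℂ) →L[ℂ] (Fin n → ℂ) := LinearMap.toContinuousLinearMap (Matrix.toLin' Ac)
  have ha (w : Fin n → ℂ) : a w = Ac *ᵥ w := by simp [a]
  let R : (Fin n → ℂ) →L[ℝ] (Fin n → ℝ) :=
    ContinuousLinearMap.pi fun i => Complex.reCLM.comp (ContinuousLinearMap.proj i)
  have hR (w : Fin n → ℂ) (i : Fin n) : R w i = (w i).re := rfl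
  have hRA (w : Fin n → ℂ) : R (a w) = A *ᵥ R w := by
    ext i
    rw [ha, hR]
    simp [Matrix.mulVec, dotProduct, hR, hAc]
  let w₀ : Fin n → ℂ := fun i => (x₀ i : ℂ)
  let w : ℝ → Fin n → ℂ := fun t => NormedSpace.exp ((t : ℂ) • a) w₀
  have hw (t : ℝ) : HasDerivAt w (a (w t)) t := by
    have h1 : HasDerivAt (fun s : ℂ => NormedSpace.exp (s • a))
        (a * NormedSpace.exp ((t : ℂ) • a)) (t : ℂ) := hasDerivAt_exp_smul_const' a (t : ℂ)
    have h2 := ((ContinuousLinearMap.apply ℂ (Fin n → ℂ) w₀).hasFDerivAt.comp_hasDerivAt _ h1)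
    simpa [Function.comp_def, w] using h2.scomp t (Complex.ofRealCLM.hasDerivAt (x := t))
  have hx (t : ℝ) : HasDerivAt (fun t => R (w t)) (A *ᵥ R (w t)) t := by
    rw [← hRA]
    exact R.hasFDerivAt.comp_hasDerivAt t (hw t)
  have hcont : Continuous fun t => R (w t) :=
    continuous_iff_continuousAt.2 fun t => (hx t).continuousAt
  refine ⟨fun t => R (w t), ?_, ?_⟩
  · have h := IsPrimitive.of_hasDerivAt hx (Continuous.matrix_mulVec continuous_const hcont)
    refine h.congr (fun _ _ => rfl) (fun _ _ => rfl) ?_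
    have h0 : w 0 = w₀ := by
      simp only [w]
      rw [Complex.ofReal_zero]
      exact congrArg (fun L : (Fin n → ℂ) →L[ℂ] (Fin n → ℂ) => L w₀)
        ((congrArg NormedSpace.exp (zero_smul ℂ a)).trans NormedSpace.exp_zero)
    ext i
    simp [h0, hR, w₀]
  · have h := tendsto_exp_smul_apply a (fun μ hμ => hA μ ?_) w₀
    · have h1 := (R.continuous.tendsto 0).comp h
      rwa [map_zero] at h1
    · have := hμ.mem_spectrum
      rwa [show (a : (Fin n → ℂ) →ₗ[ℂ] (Fin n → ℂ)) = Matrix.toLin' Ac from rfl,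
        Matrix.spectrum_toLin'] at this

/-- Carathéodory solutions exist for a locally integrable right-hand side: after subtracting the
primitive of the inhomogeneity, it is continuous and variation of constants gives a classical
solution. -/
theorem exists_solution (A : Matrix (Fin n) (Fin n) ℝ) (b : ℝ → Fin n → ℝ)
    (hb : ∀ t, 0 ≤ t → IntervalIntegrable b volume 0 t) :
    ∃ x : ℝ → Fin n → ℝ, IsPrimitive x (fun t => A *ᵥ x t + b t) 0 := by
  let a : (Fin n → ℝ) →L[ℝ] (Fin n → ℝ) := LinearMap.toContinuousLinearMap (Matrix.toLin' A)
  have ha (w : Fin n → ℝ) : a w = A *ᵥ w := by simp [a]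
  let β : ℝ → Fin n → ℝ := fun t => ∫ s in (0 : ℝ)..max t 0, b s
  have hβp : IsPrimitive β b 0 := by
    refine ⟨hb, fun t ht => ?_⟩
    simp [β, max_eq_left ht]
  have hβ : Continuous β := by
    have h1 : ContinuousOn β (Set.Ici 0) := hβp.continuousOn_Ici
    have h2 : Continuous fun t : ℝ => β (max t 0) :=
      h1.comp_continuous (by fun_prop) fun t => le_max_right t 0
    convert h2 using 2 with t
    simp [β]
  let e : ℝ → (Fin n → ℝ) →L[ℝ] (Fin n → ℝ) := fun t => NormedSpace.exp (t • a)
  have he (t : ℝ) : HasDerivAt e (a * e t) t := hasDerivAt_exp_smul_const' a t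
  have hec : Continuous e := continuous_iff_continuousAt.2 fun t => (he t).continuousAt
  have hinv (t : ℝ) (w : Fin n → ℝ) : e t (e (-t) w) = w := by
    have : e t * e (-t) = 1 := by
      have hc : Commute (t • a) ((-t) • a) := ((Commute.refl a).smul_left t).smul_right (-t)
      have h1 := exp_add_of_commute ℝ hc
      rw [← add_smul, add_neg_cancel, zero_smul, NormedSpace.exp_zero] at h1
      exact h1.symm
    exact congrArg (fun L : (Fin n → ℝ) →L[ℝ] (Fin n → ℝ) => L w) this
  let q : ℝ → Fin n → ℝ := fun s => e (-s) (a (β s))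
  have hq : Continuous q := (hec.comp continuous_neg).clm_apply (a.continuous.comp hβ)
  let I : ℝ → Fin n → ℝ := fun t => ∫ s in (0 : ℝ)..t, q s
  have hI (t : ℝ) : HasDerivAt I (q t) t :=
    intervalIntegral.integral_hasDerivAt_right (hq.intervalIntegrable 0 t)
      (hq.stronglyMeasurableAtFilter _ _) hq.continuousAt
  have hz (t : ℝ) : HasDerivAt (fun t => e t (I t)) (a (e t (I t)) + a (β t)) t := by
    have h := (he t).clm_apply (hI t)
    simpa [q, hinv] using h
  have hzc : Continuous fun t => e t (I t) :=
    continuous_iff_continuousAt.2 fun t => (hz t).continuousAt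
  have hz' := IsPrimitive.of_hasDerivAt hz
    ((a.continuous.comp hzc).add (a.continuous.comp hβ))
  refine ⟨fun t => e t (I t) + β t, (hz'.add hβp).congr (fun _ _ => rfl) (fun t _ => ?_) ?_⟩
  · simp [← ha]
  · simp [I]

end Existence

/-! ### The error bound of balanced truncation -/

section ErrorBound

variable {n m p : ℕ}

/-- The polarized form of the Sylvester equation `Aᵀ Y + Y A' + Cᵀ C' = 0`. -/
theorem sylvester_bilinear {k : ℕ} {A : Matrix (Fin n) (Fin n) ℝ} {A' : Matrix (Fin k) (Fin k) ℝ}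
    {C : Matrix (Fin p) (Fin n) ℝ} {C' : Matrix (Fin p) (Fin k) ℝ} {Y : Matrix (Fin n) (Fin k) ℝ}
    (h : Aᵀ * Y + Y * A' + Cᵀ * C' = 0) (x : Fin n → ℝ) (z : Fin k → ℝ) :
    (A *ᵥ x) ⬝ᵥ (Y *ᵥ z) + x ⬝ᵥ (Y *ᵥ (A' *ᵥ z)) = -((C *ᵥ x) ⬝ᵥ (C' *ᵥ z)) := by
  have h1 : x ⬝ᵥ ((Aᵀ * Y + Y * A' + Cᵀ * C') *ᵥ z) = 0 := by simp [h]
  rw [add_mulVec, add_mulVec, dotProduct_add, dotProduct_add, ← mulVec_mulVec, ← mulVec_mulVec,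
    ← mulVec_mulVec, dotProduct_mulVec x Aᵀ, dotProduct_mulVec x Cᵀ, vecMul_transpose,
    vecMul_transpose] at h1
  linarith

/-- The coordinate inclusion of `ℝʳ` into `ℝⁿ` as the leading `r` coordinates. -/
def incl {r : ℕ} (hr : r ≤ n) : Matrix (Fin n) (Fin r) ℝ :=
  (1 : Matrix (Fin n) (Fin n) ℝ).submatrix id (Fin.castLE hr)

/-- The vector `w` with all but its first `k` coordinates replaced by zero. -/
def head (k : ℕ) (w : Fin n → ℝ) : Fin n → ℝ := fun i => if i.val < k then w i else 0

theorem incl_mul_transpose {r : ℕ} (hr : r ≤ n) :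
    incl hr * (incl hr)ᵀ = diagonal fun i : Fin n => if i.val < r then 1 else 0 := by
  ext i j
  simp only [incl, mul_apply, submatrix_apply, transpose_apply, id, one_apply, diagonal_apply,
    mul_ite, mul_one, mul_zero]
  by_cases hi : i.val < r
  · rw [Finset.sum_eq_single ⟨i.val, hi⟩]
    · simp [Fin.ext_iff, hi, eq_comm]
    · intro b _ hb
      have : i ≠ Fin.castLE hr b := by
        rintro rfl
        exact hb rfl
      simp [this]
    · simp
  · rw [Finset.sum_eq_zero]
    · simp [hi]
    · intro b _
      have : i ≠ Fin.castLE hr b := by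
        rintro rfl
        exact hi b.2
      simp [this]

/-- The truncation to the first `k` states, kept as a system with `n` states of which the last
`n - k` remain at rest. -/
def trunc (S : LTISystem n m p) (k : ℕ) : LTISystem n m p where
  A := diagonal (fun i : Fin n => if i.val < k then (1 : ℝ) else 0) * S.A
  B := diagonal (fun i : Fin n => if i.val < k then (1 : ℝ) else 0) * S.B
  C := S.C

variable {S : LTISystem n m p} {k : ℕ} {σ : Fin n → ℝ}

theorem trunc_rhs (x : Fin n → ℝ) (u : Fin m → ℝ) :
    (trunc S k).A *ᵥ x + (trunc S k).B *ᵥ u = head k (S.A *ᵥ x + S.B *ᵥ u) := by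
  ext i
  simp only [trunc, ← mulVec_mulVec, Pi.add_apply, mulVec_diagonal, head]
  split <;> simp

theorem trunc_self : trunc S n = S := by
  simp [trunc]

theorem dotProduct_diagonal_head (d : Fin n → ℝ) (e w : Fin n → ℝ)
    (he : ∀ i : Fin n, k ≤ i.val → e i = 0) :
    e ⬝ᵥ (diagonal d *ᵥ head k w) = e ⬝ᵥ (diagonal d *ᵥ w) := by
  refine Finset.sum_congr rfl fun i _ => ?_
  rw [mulVec_diagonal, mulVec_diagonal, head]
  split_ifs with h
  · rfl
  · rw [he i (not_lt.1 h), zero_mul, zero_mul]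

theorem head_succ (hk : k < n) (w : Fin n → ℝ) :
    head k w = head (k + 1) w - Pi.single ⟨k, hk⟩ (w ⟨k, hk⟩) := by
  ext i
  by_cases hi : i = ⟨k, hk⟩
  · subst hi
    simp [head]
  · have : i.val ≠ k := fun h => hi (Fin.ext h)
    simp only [head, Pi.sub_apply, Pi.single_eq_of_ne hi, sub_zero]
    congr 1
    exact propext (by omega)

theorem dotProduct_diagonal_comm (d e w : Fin n → ℝ) :
    w ⬝ᵥ (diagonal d *ᵥ e) = e ⬝ᵥ (diagonal d *ᵥ w) := by
  refine Finset.sum_congr rfl fun i _ => ?_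
  rw [mulVec_diagonal, mulVec_diagonal]
  ring

/-- The dissipation inequality behind the one-step error bound.  The storage function is
`eᵀ Σ e + σ_k² sᵀ Σ⁻¹ s` for the difference `e` and the sum `s` of the two states; the contributions
of the removed state to its two parts cancel. -/
theorem dissipation_step (hσ : ∀ i, 0 < σ i)
    (hP : S.A * diagonal σ + diagonal σ * S.Aᵀ + S.B * S.Bᵀ = 0)
    (hQ : S.Aᵀ * diagonal σ + diagonal σ * S.A + S.Cᵀ * S.C = 0)
    (hk : k < n) (x z : Fin n → ℝ) (u : Fin m → ℝ)
    (hx : ∀ i : Fin n, k + 1 ≤ i.val → x i = 0) (hz : ∀ i : Fin n, k ≤ i.val → z i = 0) :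
    2 * ((x - z) ⬝ᵥ (diagonal σ *ᵥ
        (head (k + 1) (S.A *ᵥ x + S.B *ᵥ u) - head k (S.A *ᵥ z + S.B *ᵥ u)))) +
      σ ⟨k, hk⟩ ^ 2 * (2 * ((x + z) ⬝ᵥ (diagonal (fun i => (σ i)⁻¹) *ᵥ
        (head (k + 1) (S.A *ᵥ x + S.B *ᵥ u) + head k (S.A *ᵥ z + S.B *ᵥ u))))) ≤
    4 * σ ⟨k, hk⟩ ^ 2 * (u ⬝ᵥ u) - (S.C *ᵥ x - S.C *ᵥ z) ⬝ᵥ (S.C *ᵥ x - S.C *ᵥ z) := by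
  set j : Fin n := ⟨k, hk⟩ with hj
  set w := S.A *ᵥ z + S.B *ᵥ u with hw
  have hzj : z j = 0 := hz j le_rfl
  have he : ∀ i : Fin n, k + 1 ≤ i.val → (x - z) i = 0 := fun i hi => by
    simp [hx i hi, hz i (by omega)]
  have hs : ∀ i : Fin n, k + 1 ≤ i.val → (x + z) i = 0 := fun i hi => by
    simp [hx i hi, hz i (by omega)]
  set q : Fin n → ℝ := diagonal (fun i => (σ i)⁻¹) *ᵥ (x + z) with hq
  have hDq : diagonal σ *ᵥ q = x + z := by
    ext i
    simp [hq, mulVec_diagonal, (hσ i).ne']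
  have e1 : (x - z) ⬝ᵥ (diagonal σ *ᵥ (head (k + 1) (S.A *ᵥ x + S.B *ᵥ u) - head k w)) =
      (x - z) ⬝ᵥ (diagonal σ *ᵥ (S.A *ᵥ (x - z))) + x j * (σ j * w j) := by
    rw [head_succ hk, mulVec_sub, mulVec_sub, dotProduct_sub, dotProduct_sub,
      dotProduct_diagonal_head _ _ _ he, dotProduct_diagonal_head _ _ _ he, hw, mulVec_sub]
    simp only [mulVec_sub, mulVec_add, dotProduct_sub, dotProduct_add]
    rw [← hj, diagonal_mulVec_single, dotProduct_single]
    simp [hzj]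
    ring
  have e2 : (x + z) ⬝ᵥ (diagonal (fun i => (σ i)⁻¹) *ᵥ
        (head (k + 1) (S.A *ᵥ x + S.B *ᵥ u) + head k w)) =
      q ⬝ᵥ (S.A *ᵥ (x + z)) + 2 * (q ⬝ᵥ (S.B *ᵥ u)) - x j * ((σ j)⁻¹ * w j) := by
    rw [head_succ hk, mulVec_add, mulVec_sub, dotProduct_add, dotProduct_sub,
      dotProduct_diagonal_head _ _ _ hs, dotProduct_diagonal_head _ _ _ hs,
      dotProduct_diagonal_comm, dotProduct_diagonal_comm _ w, ← hq, hw]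
    rw [← hj, diagonal_mulVec_single, dotProduct_single]
    simp only [mulVec_add, dotProduct_add, Pi.add_apply, hzj, dotProduct_comm _ q]
    ring
  have e3 := sylvester_bilinear hQ (x - z) (x - z)
  rw [dotProduct_diagonal_comm] at e3
  have e4 : q ⬝ᵥ (S.A *ᵥ (x + z)) * 2 = -((S.Bᵀ *ᵥ q) ⬝ᵥ (S.Bᵀ *ᵥ q)) := by
    have h := sylvester_bilinear (A := S.Aᵀ) (C := S.Bᵀ) (A' := S.Aᵀ) (C' := S.Bᵀ)
      (Y := diagonal σ) (by simpa using hP) q q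
    rw [dotProduct_diagonal_comm, ← dotProduct_diagonal_comm, hDq, mulVec_transpose,
      ← dotProduct_mulVec] at h
    linarith
  have e5 : q ⬝ᵥ (S.B *ᵥ u) = (S.Bᵀ *ᵥ q) ⬝ᵥ u := by
    rw [dotProduct_mulVec, mulVec_transpose]
  have e6 : 0 ≤ (S.Bᵀ *ᵥ q - (2 : ℝ) • u) ⬝ᵥ (S.Bᵀ *ᵥ q - (2 : ℝ) • u) := by
    simpa using dotProduct_star_self_nonneg (S.Bᵀ *ᵥ q - (2 : ℝ) • u)
  have e7 : (S.Bᵀ *ᵥ q - (2 : ℝ) • u) ⬝ᵥ (S.Bᵀ *ᵥ q - (2 : ℝ) • u) =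
      (S.Bᵀ *ᵥ q) ⬝ᵥ (S.Bᵀ *ᵥ q) - 4 * ((S.Bᵀ *ᵥ q) ⬝ᵥ u) + 4 * (u ⬝ᵥ u) := by
    simp only [sub_dotProduct, dotProduct_sub, smul_dotProduct, dotProduct_smul, smul_eq_mul,
      dotProduct_comm u]
    ring
  have hjne : σ j ≠ 0 := (hσ j).ne'
  rw [e1, e2, ← mulVec_sub]
  have e8 : σ j ^ 2 * (x j * ((σ j)⁻¹ * w j)) = x j * (σ j * w j) := by
    field_simp
  have e9 := mul_nonneg (sq_nonneg (σ j)) (e7 ▸ e6)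
  rw [e5]
  nlinarith [e3, e4, e8, e9]

variable {u : ℝ → Fin m → ℝ} {x z : ℝ → Fin n → ℝ}

theorem _root_.LTISystem.IsTrajectory.isPrimitive {S : LTISystem n m p} {x₀ : Fin n → ℝ}
    (h : S.IsTrajectory u x₀ x) :
    IsPrimitive x (fun t => S.A *ᵥ x t + S.B *ᵥ u t) x₀ :=
  ⟨h.integrable, h.eq_integral⟩

theorem trunc_isPrimitive (h : (trunc S k).IsTrajectory u 0 x) :
    IsPrimitive x (fun t => head k (S.A *ᵥ x t + S.B *ᵥ u t)) 0 :=
  h.isPrimitive.congr (fun _ _ => rfl) (fun _ _ => (trunc_rhs _ _).symm) rfl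

theorem trunc_apply_eq_zero (h : (trunc S k).IsTrajectory u 0 x) {t : ℝ} (ht : 0 ≤ t) (i : Fin n)
    (hi : k ≤ i.val) : x t i = 0 := by
  have h1 := ((trunc_isPrimitive h).apply i).eq_integral t ht
  simpa [head, not_lt.2 hi] using h1

theorem diagonal_dotProduct_nonneg {d : Fin n → ℝ} (hd : ∀ i, 0 < d i) (e : Fin n → ℝ) :
    0 ≤ e ⬝ᵥ (diagonal d *ᵥ e) := by
  refine Finset.sum_nonneg fun i _ => ?_
  rw [mulVec_diagonal, mul_left_comm]
  exact mul_nonneg (hd i).le (mul_self_nonneg _)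

theorem continuousOn_dotProduct_self {k : ℕ} {f : ℝ → Fin k → ℝ} {s : Set ℝ}
    (hf : ContinuousOn f s) : ContinuousOn (fun t => f t ⬝ᵥ f t) s := by
  have : Continuous fun a : Fin k → ℝ => a ⬝ᵥ a := by fun_prop
  exact this.comp_continuousOn hf

/-- Removing one state of a balanced system changes the output by at most twice the corresponding
Hankel singular value times the norm of the input. -/
theorem hasL2Bound_step (hσ : ∀ i, 0 < σ i)
    (hP : S.A * diagonal σ + diagonal σ * S.Aᵀ + S.B * S.Bᵀ = 0)
    (hQ : S.Aᵀ * diagonal σ + diagonal σ * S.A + S.Cᵀ * S.C = 0)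
    (hu : MemL2 u) (hk : k < n) (hx : (trunc S (k + 1)).IsTrajectory u 0 x)
    (hz : (trunc S k).IsTrajectory u 0 z) :
    HasL2Bound (fun t => S.C *ᵥ x t - S.C *ᵥ z t) (2 * σ ⟨k, hk⟩ * normL2 u) := by
  have px := trunc_isPrimitive hx
  have pz := trunc_isPrimitive hz
  have pe := px.sub pz
  have ps := px.add pz
  have py := (px.mulVec S.C).sub (pz.mulVec S.C)
  have pV := (pe.dotProduct (pe.mulVec (diagonal σ))).add
    ((ps.dotProduct (ps.mulVec (diagonal fun i => (σ i)⁻¹))).map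
      (LinearMap.toContinuousLinearMap (LinearMap.mulLeft ℝ (σ ⟨k, hk⟩ ^ 2))))
  refine HasL2Bound.of_energy py.continuousOn_Ici
    (mul_nonneg (mul_nonneg zero_le_two (hσ _).le) (normL2_nonneg u)) fun T hT => ?_
  have hi1 : IntervalIntegrable (fun t => 4 * σ ⟨k, hk⟩ ^ 2 * (u t ⬝ᵥ u t)) volume 0 T :=
    (hu.intervalIntegrable_dotProduct hT).const_mul _
  have hi2 : IntervalIntegrable (fun t => (S.C *ᵥ x t - S.C *ᵥ z t) ⬝ᵥ
      (S.C *ᵥ x t - S.C *ᵥ z t)) volume 0 T :=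
    (continuousOn_dotProduct_self (py.continuousOn hT)).intervalIntegrable
  have h := pV.le_add_integral hT (hi1.sub hi2) (fun t ht => by
    have h := dissipation_step hσ hP hQ hk (x t) (z t) (u t)
      (fun i hi => trunc_apply_eq_zero hx ht i hi) (fun i hi => trunc_apply_eq_zero hz ht i hi)
    refine le_trans (le_of_eq ?_) h
    rw [dotProduct_diagonal_comm σ, dotProduct_diagonal_comm (fun i => (σ i)⁻¹)]
    simp only [LinearMap.coe_toContinuousLinearMap', LinearMap.mulLeft_apply, ← two_mul])
  rw [intervalIntegral.integral_sub hi1 hi2, intervalIntegral.integral_const_mul] at h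
  have hV1 := diagonal_dotProduct_nonneg hσ (x T - z T)
  have hV2 := mul_nonneg (sq_nonneg (σ ⟨k, hk⟩))
    (diagonal_dotProduct_nonneg (fun i => inv_pos.2 (hσ i)) (x T + z T))
  simp only [LinearMap.coe_toContinuousLinearMap', LinearMap.mulLeft_apply, sub_zero, add_zero,
    mulVec_zero, dotProduct_zero, mul_zero, zero_add] at h
  have hE := mul_le_mul_of_nonneg_left (hu.energy_le hT)
    (mul_nonneg zero_le_four (sq_nonneg (σ ⟨k, hk⟩)))
  calc _ ≤ 4 * σ ⟨k, hk⟩ ^ 2 * ∫ t in (0 : ℝ)..T, u t ⬝ᵥ u t := by linarith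
    _ ≤ 4 * σ ⟨k, hk⟩ ^ 2 * normL2 u ^ 2 := hE
    _ = _ := by ring

/-- The output of a truncated system is determined by its input. -/
theorem hasL2Bound_self (hσ : ∀ i, 0 < σ i)
    (hQ : S.Aᵀ * diagonal σ + diagonal σ * S.A + S.Cᵀ * S.C = 0)
    (hx : (trunc S k).IsTrajectory u 0 x) (hz : (trunc S k).IsTrajectory u 0 z) :
    HasL2Bound (fun t => S.C *ᵥ x t - S.C *ᵥ z t) 0 := by
  have px := trunc_isPrimitive hx
  have pz := trunc_isPrimitive hz
  have pe := px.sub pz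
  have py := (px.mulVec S.C).sub (pz.mulVec S.C)
  have pV := pe.dotProduct (pe.mulVec (diagonal σ))
  refine HasL2Bound.of_energy py.continuousOn_Ici le_rfl fun T hT => ?_
  have hi : IntervalIntegrable (fun t => (S.C *ᵥ x t - S.C *ᵥ z t) ⬝ᵥ
      (S.C *ᵥ x t - S.C *ᵥ z t)) volume 0 T :=
    (continuousOn_dotProduct_self (py.continuousOn hT)).intervalIntegrable
  have h := pV.le_add_integral hT hi.neg (fun t ht => by
    have he : ∀ i : Fin n, k ≤ i.val → (x t - z t) i = 0 := fun i hi => by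
      simp [trunc_apply_eq_zero hx ht i hi, trunc_apply_eq_zero hz ht i hi]
    have h := sylvester_bilinear hQ (x t - z t) (x t - z t)
    rw [dotProduct_diagonal_comm] at h
    rw [dotProduct_diagonal_comm, mulVec_sub, dotProduct_sub, dotProduct_diagonal_head _ _ _ he,
      dotProduct_diagonal_head _ _ _ he, ← dotProduct_sub, ← mulVec_sub, add_sub_add_right_eq_sub,
      ← mulVec_sub, h, Pi.neg_apply, ← mulVec_sub])
  have hV := diagonal_dotProduct_nonneg hσ (x T - z T)
  simp only [sub_zero, mulVec_zero, dotProduct_zero, zero_add, Pi.neg_apply,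
    intervalIntegral.integral_neg] at h
  linarith

theorem exists_trajectory (S : LTISystem n m p) (hu : MemL2 u) :
    ∃ x, S.IsTrajectory u 0 x := by
  obtain ⟨x, hx⟩ := exists_solution S.A (fun t => S.B *ᵥ u t) fun t ht => by
    have h := hu.intervalIntegrable ht
    rw [intervalIntegrable_iff] at h ⊢
    exact (LinearMap.toContinuousLinearMap S.B.mulVecLin).integrable_comp h
  exact ⟨x, hx.integrable, hx.eq_integral⟩

/-- The one-step bounds add up along the chain of truncations from order `k` down to order `r`. -/
theorem hasL2Bound_trunc (hσ : ∀ i, 0 < σ i)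
    (hP : S.A * diagonal σ + diagonal σ * S.Aᵀ + S.B * S.Bᵀ = 0)
    (hQ : S.Aᵀ * diagonal σ + diagonal σ * S.A + S.Cᵀ * S.C = 0)
    (hu : MemL2 u) {r : ℕ} (hz : (trunc S r).IsTrajectory u 0 z) (hrk : r ≤ k) :
    k ≤ n → ∀ x, (trunc S k).IsTrajectory u 0 x →
      HasL2Bound (fun t => S.C *ᵥ x t - S.C *ᵥ z t)
        (2 * (∑ i : Fin n with r ≤ i.val ∧ i.val < k, σ i) * normL2 u) := by
  induction k, hrk using Nat.le_induction with
  | base =>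
    intro _ x hx
    have : ∀ i : Fin n, ¬ (r ≤ i.val ∧ i.val < r) := fun i => by omega
    simpa [this] using hasL2Bound_self hσ hQ hx hz
  | succ k hrk ih =>
    intro hk x hx
    obtain ⟨w, hw⟩ := exists_trajectory (trunc S k) hu
    have hsum : ∑ i : Fin n with r ≤ i.val ∧ i.val < k + 1, σ i =
        σ ⟨k, hk⟩ + ∑ i : Fin n with r ≤ i.val ∧ i.val < k, σ i := by
      rw [← Finset.sum_insert (by simp)]
      congr 1
      ext i
      simp only [Finset.mem_filter, Finset.mem_univ, true_and, Finset.mem_insert, Fin.ext_iff]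
      omega
    have h := (hasL2Bound_step hσ hP hQ hu hk hx hw).add (ih (by omega) w hw)
      (mul_nonneg (mul_nonneg zero_le_two (hσ _).le) (normL2_nonneg u))
      (mul_nonneg (mul_nonneg zero_le_two (Finset.sum_nonneg fun i _ => (hσ i).le))
        (normL2_nonneg u))
    rw [hsum, mul_add, add_mul]
    exact h.congr fun t _ => by abel

/-- A trajectory of the leading subsystem, padded with zeros, is a trajectory of the truncation. -/
theorem trunc_isTrajectory_of_project {r : ℕ} (hr : r ≤ n) {ξ : ℝ → Fin r → ℝ}
    (h : (S.project (incl hr) (incl hr)).IsTrajectory u 0 ξ) :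
    (trunc S r).IsTrajectory u 0 (fun t => incl hr *ᵥ ξ t) := by
  have h1 := (h.isPrimitive.mulVec (incl hr)).congr (x' := fun t => incl hr *ᵥ ξ t)
    (v' := fun t => (trunc S r).A *ᵥ (incl hr *ᵥ ξ t) + (trunc S r).B *ᵥ u t) (x₀' := 0)
    (fun _ _ => rfl) (fun t _ => by
      simp only [trunc, ← incl_mul_transpose hr, LTISystem.project, mulVec_add, mulVec_mulVec,
        Matrix.mul_assoc]) (by simp)
  exact ⟨h1.integrable, h1.eq_integral⟩

/-- The error bound for truncating a balanced system: twice the sum of the removed Hankel singular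
values. -/
theorem hasL2Bound_project (hσ : ∀ i, 0 < σ i)
    (hP : S.A * diagonal σ + diagonal σ * S.Aᵀ + S.B * S.Bᵀ = 0)
    (hQ : S.Aᵀ * diagonal σ + diagonal σ * S.A + S.Cᵀ * S.C = 0)
    (hu : MemL2 u) {r : ℕ} (hr : r ≤ n) (hx : S.IsTrajectory u 0 x) {ξ : ℝ → Fin r → ℝ}
    (hξ : (S.project (incl hr) (incl hr)).IsTrajectory u 0 ξ) :
    HasL2Bound (fun t => S.C *ᵥ x t - (S.project (incl hr) (incl hr)).C *ᵥ ξ t)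
      (2 * truncatedSum r σ * normL2 u) := by
  have h := hasL2Bound_trunc hσ hP hQ hu (trunc_isTrajectory_of_project hr hξ) hr le_rfl x
    (by rwa [trunc_self])
  simpa [LTISystem.project, truncatedSum, mulVec_mulVec] using h

end ErrorBound

/-! ### The error in the response to the initial state -/

section InitialState

variable {n m p r : ℕ}

theorem exists_homogeneous_solution (A : Matrix (Fin n) (Fin n) ℝ) (x₀ : Fin n → ℝ) :
    ∃ x : ℝ → Fin n → ℝ, IsPrimitive x (fun t => A *ᵥ x t) x₀ := by
  obtain ⟨w, hw⟩ := exists_solution A (fun _ => A *ᵥ x₀) fun t _ => intervalIntegrable_const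
  have hc : IsPrimitive (fun _ : ℝ => x₀) (fun _ => 0) x₀ :=
    ⟨fun _ _ => intervalIntegrable_const, fun t _ => by simp⟩
  exact ⟨fun t => w t + x₀, (hw.add hc).congr (fun _ _ => rfl)
    (fun t _ => by simp [mulVec_add]) (by simp)⟩

theorem transpose_incl_mul_diagonal (hr : r ≤ n) (d : Fin n → ℝ) :
    (incl hr)ᵀ * diagonal d = diagonal (fun i => d (Fin.castLE hr i)) * (incl hr)ᵀ := by
  ext i j
  simp only [mul_diagonal, diagonal_mul, transpose_apply, incl, submatrix_apply, id, one_apply]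
  split_ifs with h
  · rw [h]; ring
  · ring

theorem diagonal_mul_incl (hr : r ≤ n) (d : Fin n → ℝ) :
    diagonal d * incl hr = incl hr * diagonal (fun i => d (Fin.castLE hr i)) := by
  simpa using congrArg transpose (transpose_incl_mul_diagonal hr d)

theorem mul_incl {l : ℕ} (hr : r ≤ n) (M : Matrix (Fin l) (Fin n) ℝ) :
    M * incl hr = M.submatrix id (Fin.castLE hr) := by
  ext i j
  simp [incl, mul_apply, one_apply]

theorem transpose_incl_mul {l : ℕ} (hr : r ≤ n) (M : Matrix (Fin n) (Fin l) ℝ) :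
    (incl hr)ᵀ * M = M.submatrix (Fin.castLE hr) id := by
  ext i j
  simp [incl, mul_apply, one_apply]

variable {S : LTISystem n m p} {θ : Fin n → ℝ} {Y : Matrix (Fin n) (Fin r) ℝ}

theorem project_reachability (hr : r ≤ n)
    (hP : S.A * diagonal θ + diagonal θ * S.Aᵀ + S.B * S.Bᵀ = 0) :
    (S.project (incl hr) (incl hr)).A * diagonal (fun i => θ (Fin.castLE hr i)) +
      diagonal (fun i => θ (Fin.castLE hr i)) * (S.project (incl hr) (incl hr)).Aᵀ +
      (S.project (incl hr) (incl hr)).B * (S.project (incl hr) (incl hr)).Bᵀ = 0 := by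
  have h := congrArg (fun M => (incl hr)ᵀ * M * incl hr) hP
  simp only [Matrix.mul_add, Matrix.add_mul, Matrix.mul_zero, Matrix.zero_mul] at h
  rw [← h]
  simp only [LTISystem.project, transpose_mul, transpose_transpose, Matrix.mul_assoc,
    diagonal_mul_incl]
  simp only [← Matrix.mul_assoc, transpose_incl_mul_diagonal]

theorem project_observability (hr : r ≤ n)
    (hQ : S.Aᵀ * diagonal θ + diagonal θ * S.A + S.Cᵀ * S.C = 0) :
    (S.project (incl hr) (incl hr)).Aᵀ * diagonal (fun i => θ (Fin.castLE hr i)) +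
      diagonal (fun i => θ (Fin.castLE hr i)) * (S.project (incl hr) (incl hr)).A +
      (S.project (incl hr) (incl hr)).Cᵀ * (S.project (incl hr) (incl hr)).C = 0 := by
  have h := congrArg (fun M => (incl hr)ᵀ * M * incl hr) hQ
  simp only [Matrix.mul_add, Matrix.add_mul, Matrix.mul_zero, Matrix.zero_mul] at h
  rw [← h]
  simp only [LTISystem.project, transpose_mul, transpose_transpose, Matrix.mul_assoc,
    diagonal_mul_incl]
  simp only [← Matrix.mul_assoc, transpose_incl_mul_diagonal]

theorem solvesSylvester_iff (hr : r ≤ n) :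
    SolvesSylvester hr S Y ↔ S.Aᵀ * Y + Y * (S.project (incl hr) (incl hr)).A +
      S.Cᵀ * (S.project (incl hr) (incl hr)).C = 0 := by
  rw [SolvesSylvester]
  simp only [LTISystem.project, mul_incl, transpose_incl_mul, submatrix_submatrix,
    Function.comp_id, Function.id_comp]

/-- The matrix `N` for which `zᵀ N z` is the value of `xᵀ Θ x - 2 xᵀ Y ξ + ξᵀ Θ₁ ξ`, the quadratic form
of the observability Gramian of the error system, at the initial states `x = B z` and `ξ = B₁ z` of
the system and of its leading subsystem of order `r`. -/
def errorGramian (hr : r ≤ n) (S : LTISystem n m p) (θ : Fin n → ℝ)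
    (Y : Matrix (Fin n) (Fin r) ℝ) : Matrix (Fin m) (Fin m) ℝ :=
  S.Bᵀ * diagonal θ * S.B - (2 : ℝ) • (S.Bᵀ * Y * (S.project (incl hr) (incl hr)).B) +
    (S.project (incl hr) (incl hr)).Bᵀ * diagonal (fun i => θ (Fin.castLE hr i)) *
      (S.project (incl hr) (incl hr)).B

theorem dotProduct_transpose_mul_mulVec {a b c d : ℕ} (B : Matrix (Fin a) (Fin b) ℝ)
    (M : Matrix (Fin a) (Fin c) ℝ) (B' : Matrix (Fin c) (Fin d) ℝ) (z : Fin b → ℝ)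
    (w : Fin d → ℝ) : z ⬝ᵥ ((Bᵀ * M * B') *ᵥ w) = (B *ᵥ z) ⬝ᵥ (M *ᵥ (B' *ᵥ w)) := by
  rw [Matrix.mul_assoc, ← mulVec_mulVec, dotProduct_mulVec, vecMul_transpose, mulVec_mulVec]

theorem two_mul_dotProduct_le {d : Fin r → ℝ} (hd : ∀ i, 0 < d i) (a b : Fin r → ℝ) :
    2 * (a ⬝ᵥ b) ≤ b ⬝ᵥ (diagonal d *ᵥ b) + a ⬝ᵥ (diagonal (fun i => (d i)⁻¹) *ᵥ a) := by
  simp only [dotProduct, mulVec_diagonal, Finset.mul_sum, ← Finset.sum_add_distrib]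
  refine Finset.sum_le_sum fun i _ => ?_
  have h := mul_nonneg (inv_pos.2 (hd i)).le (sq_nonneg (a i - d i * b i))
  have h2 : (d i)⁻¹ * (a i - d i * b i) ^ 2 =
      b i * (d i * b i) + a i * ((d i)⁻¹ * a i) - 2 * (a i * b i) := by
    have := (hd i).ne'
    field_simp
    ring
  linarith

/-- The energy of the error in the response to the initial state.  The derivative of
`V = xᵀ Θ x - 2 xᵀ Y ξ + ξᵀ Θ₁ ξ` is minus the squared error.  Since `x` tends to zero, completing the
square in `ξ` shows that the lower limit of `V` is nonnegative, whether or not `ξ` decays. -/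
theorem energy_le_errorGramian (hθ : ∀ i, 0 < θ i)
    (hQ : S.Aᵀ * diagonal θ + diagonal θ * S.A + S.Cᵀ * S.C = 0)
    (hr : r ≤ n) (hY : SolvesSylvester hr S Y) (z : Fin m → ℝ) {x : ℝ → Fin n → ℝ}
    (hx : IsPrimitive x (fun t => S.A *ᵥ x t) (S.B *ᵥ z)) (hx0 : Tendsto x atTop (𝓝 0))
    {ξ : ℝ → Fin r → ℝ}
    (hξ : IsPrimitive ξ (fun t => (S.project (incl hr) (incl hr)).A *ᵥ ξ t)
      ((S.project (incl hr) (incl hr)).B *ᵥ z)) {T : ℝ} (hT : 0 ≤ T) :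
    ∫ t in (0 : ℝ)..T, (S.C *ᵥ x t - (S.project (incl hr) (incl hr)).C *ᵥ ξ t) ⬝ᵥ
      (S.C *ᵥ x t - (S.project (incl hr) (incl hr)).C *ᵥ ξ t) ≤
      z ⬝ᵥ (errorGramian hr S θ Y *ᵥ z) := by
  have hQ₁ := project_observability hr hQ
  rw [solvesSylvester_iff] at hY
  set S₁ := S.project (incl hr) (incl hr) with hS₁
  set θ₁ : Fin r → ℝ := fun i => θ (Fin.castLE hr i) with hθ₁
  set err : ℝ → Fin p → ℝ := fun t => S.C *ᵥ x t - S₁.C *ᵥ ξ t with herr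
  have perr := (hx.mulVec S.C).sub (hξ.mulVec S₁.C)
  have pV := ((hx.dotProduct (hx.mulVec (diagonal θ))).sub
    ((hx.dotProduct (hξ.mulVec Y)).map
      (LinearMap.toContinuousLinearMap (LinearMap.mulLeft ℝ (2 : ℝ))))).add
    (hξ.dotProduct (hξ.mulVec (diagonal θ₁)))
  simp only [LinearMap.coe_toContinuousLinearMap', LinearMap.mulLeft_apply] at pV
  have hi (T : ℝ) (hT : 0 ≤ T) : IntervalIntegrable (fun t => err t ⬝ᵥ err t) volume 0 T :=
    (continuousOn_dotProduct_self (perr.continuousOn hT)).intervalIntegrable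
  have hnn (t : ℝ) : 0 ≤ err t ⬝ᵥ err t := by
    simpa using dotProduct_star_self_nonneg (err t)
  have hbound (T : ℝ) (hT : 0 ≤ T) : ∫ t in (0 : ℝ)..T, err t ⬝ᵥ err t ≤
      z ⬝ᵥ (errorGramian hr S θ Y *ᵥ z) +
        (Yᵀ *ᵥ x T) ⬝ᵥ (diagonal (fun i => (θ₁ i)⁻¹) *ᵥ (Yᵀ *ᵥ x T)) := by
    have h := pV.le_add_integral hT (hi T hT).neg (fun t _ => by
      rw [sylvester_bilinear hQ, sylvester_bilinear hY, sylvester_bilinear hQ₁]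
      simp only [herr, Pi.neg_apply, sub_dotProduct, dotProduct_sub,
        dotProduct_comm (S₁.C *ᵥ ξ t) (S.C *ᵥ x t)]
      linarith)
    simp only [Pi.neg_apply, intervalIntegral.integral_neg] at h
    have h0 : z ⬝ᵥ (errorGramian hr S θ Y *ᵥ z) =
        (S.B *ᵥ z) ⬝ᵥ (diagonal θ *ᵥ (S.B *ᵥ z)) - 2 * ((S.B *ᵥ z) ⬝ᵥ (Y *ᵥ (S₁.B *ᵥ z))) +
          (S₁.B *ᵥ z) ⬝ᵥ (diagonal θ₁ *ᵥ (S₁.B *ᵥ z)) := by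
      rw [errorGramian, add_mulVec, sub_mulVec, smul_mulVec, dotProduct_add, dotProduct_sub,
        dotProduct_smul, dotProduct_transpose_mul_mulVec, dotProduct_transpose_mul_mulVec,
        dotProduct_transpose_mul_mulVec, smul_eq_mul]
    have h1 := two_mul_dotProduct_le (d := θ₁) (fun i => hθ _) (Yᵀ *ᵥ x T) (ξ T)
    have h2 : (Yᵀ *ᵥ x T) ⬝ᵥ ξ T = x T ⬝ᵥ (Y *ᵥ ξ T) := by
      rw [dotProduct_mulVec, mulVec_transpose]
    have h3 := diagonal_dotProduct_nonneg hθ (x T)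
    rw [h0]
    rw [h2] at h1
    linarith
  have hlim : Tendsto (fun T => z ⬝ᵥ (errorGramian hr S θ Y *ᵥ z) +
      (Yᵀ *ᵥ x T) ⬝ᵥ (diagonal (fun i => (θ₁ i)⁻¹) *ᵥ (Yᵀ *ᵥ x T))) atTop
      (𝓝 (z ⬝ᵥ (errorGramian hr S θ Y *ᵥ z))) := by
    have hc : Continuous fun a : Fin n → ℝ => z ⬝ᵥ (errorGramian hr S θ Y *ᵥ z) +
        (Yᵀ *ᵥ a) ⬝ᵥ (diagonal (fun i => (θ₁ i)⁻¹) *ᵥ (Yᵀ *ᵥ a)) := by fun_prop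
    have h := (hc.tendsto 0).comp hx0
    simp only [mulVec_zero, zero_dotProduct, add_zero] at h
    exact h
  refine ge_of_tendsto hlim ?_
  filter_upwards [eventually_ge_atTop T] with T' hT'
  refine le_trans ?_ (hbound T' (hT.trans hT'))
  exact intervalIntegral.integral_mono_interval le_rfl hT hT' (.of_forall hnn)
    (hi T' (hT.trans hT'))

/-- A nonnegative quadratic form is bounded by its trace. -/
theorem dotProduct_mulVec_le_trace {N : Matrix (Fin m) (Fin m) ℝ}
    (hN : ∀ z, 0 ≤ z ⬝ᵥ (N *ᵥ z)) (z : Fin m → ℝ) :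
    0 ≤ N.trace ∧ z ⬝ᵥ (N *ᵥ z) ≤ N.trace * (z ⬝ᵥ z) := by
  have hT (z : Fin m → ℝ) : z ⬝ᵥ (Nᵀ *ᵥ z) = z ⬝ᵥ (N *ᵥ z) := by
    rw [dotProduct_mulVec, vecMul_transpose, dotProduct_comm]
  have hpsd : (N + Nᵀ).PosSemidef := by
    refine PosSemidef.of_dotProduct_mulVec_nonneg ?_ fun w => ?_
    · simp [IsHermitian, conjTranspose_eq_transpose_of_trivial, add_comm]
    · rw [star_trivial, add_mulVec, dotProduct_add, hT]
      exact add_nonneg (hN w) (hN w)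
  obtain ⟨k, v, hv⟩ := posSemidef_iff_eq_sum_vecMulVec.1 hpsd
  simp only [star_trivial] at hv
  have htr : 2 * N.trace = ∑ i, v i ⬝ᵥ v i := by
    have h := congrArg trace hv
    rw [trace_add, trace_transpose, trace_sum] at h
    simp only [trace_vecMulVec] at h
    linarith
  have hquad : 2 * (z ⬝ᵥ (N *ᵥ z)) = ∑ i, (v i ⬝ᵥ z) ^ 2 := by
    have h := congrArg (fun M => z ⬝ᵥ (M *ᵥ z)) hv
    simp only [add_mulVec, dotProduct_add, hT, sum_mulVec, dotProduct_sum] at h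
    rw [two_mul, h]
    refine Finset.sum_congr rfl fun i _ => ?_
    rw [vecMulVec_mulVec, dotProduct_smul, dotProduct_comm z, sq]
    rfl
  constructor
  · have : 0 ≤ ∑ i, v i ⬝ᵥ v i :=
      Finset.sum_nonneg fun i _ => by simpa using dotProduct_star_self_nonneg (v i)
    linarith
  · have h : ∑ i, (v i ⬝ᵥ z) ^ 2 ≤ (∑ i, v i ⬝ᵥ v i) * (z ⬝ᵥ z) := by
      rw [Finset.sum_mul]
      refine Finset.sum_le_sum fun i _ => ?_
      have := Finset.sum_mul_sq_le_sq_mul_sq Finset.univ (v i) z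
      simpa [dotProduct, sq] using this
    rw [← htr, ← hquad] at h
    linarith

theorem trace_eq_head_add_tail (hr : r ≤ n) (M : Matrix (Fin n) (Fin n) ℝ) :
    M.trace = (M.submatrix (Fin.castLE hr) (Fin.castLE hr)).trace +
      (M.submatrix (tailIdx hr) (tailIdx hr)).trace := by
  obtain ⟨k, rfl⟩ := Nat.exists_eq_add_of_le hr
  simp only [trace, diag_apply, submatrix_apply, Fin.sum_univ_add]
  congr 1
  refine (Fintype.sum_equiv (finCongr (by omega)) _ _ fun i => ?_)
  congr 1

/-- The trace of the error Gramian in terms of the truncated blocks. -/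
theorem trace_errorGramian (hr : r ≤ n)
    (hP : S.A * diagonal θ + diagonal θ * S.Aᵀ + S.B * S.Bᵀ = 0)
    (hQ : S.Aᵀ * diagonal θ + diagonal θ * S.A + S.Cᵀ * S.C = 0)
    (hY : SolvesSylvester hr S Y) :
    (errorGramian hr S θ Y).trace = traceTTheta hr S θ Y := by
  have hP₁ := project_reachability hr hP
  have hQ₁ := project_observability hr hQ
  rw [solvesSylvester_iff] at hY
  set S₁ := S.project (incl hr) (incl hr) with hS₁
  set D := diagonal θ
  set D₁ := diagonal fun i => θ (Fin.castLE hr i) with hD₁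
  set E := incl hr
  have hED : Eᵀ * D = D₁ * Eᵀ := transpose_incl_mul_diagonal hr θ
  have hDE : D * E = E * D₁ := diagonal_mul_incl hr θ
  -- the defining expression is a partial trace
  have h1 : ((S.B * S.Bᵀ + (2 : ℝ) • (Y * (Eᵀ * S.A))) * D).trace =
      ((S₁.B * S₁.Bᵀ + (2 : ℝ) • ((Eᵀ * Y) * S₁.A)) * D₁).trace + traceTTheta hr S θ Y := by
    rw [trace_eq_head_add_tail hr]
    congr 1
    · congr 1
      have hsub (M : Matrix (Fin n) (Fin n) ℝ) :
          M.submatrix (Fin.castLE hr) (Fin.castLE hr) = Eᵀ * (M * E) := by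
        rw [mul_incl, transpose_incl_mul]
        rfl
      rw [hsub]
      simp only [hS₁, LTISystem.project, Matrix.mul_add, Matrix.add_mul, transpose_mul,
        transpose_transpose, Matrix.mul_assoc, Matrix.mul_smul, Matrix.smul_mul]
      rw [← hDE]
    · simp only [traceTTheta, trace, diag_apply, D, mul_diagonal, submatrix_apply]
      refine Finset.sum_congr rfl fun i _ => ?_
      simp [mul_apply, E, transpose_incl_mul]
  -- the off-diagonal block of the reachability equation, tested with `Y`
  have h2 : (Y * Eᵀ * (S.B * S.Bᵀ)).trace =
      -(Y * Eᵀ * (S.A * D)).trace - (Y * Eᵀ * (D * S.Aᵀ)).trace := by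
    have h := congrArg (fun M => (Y * Eᵀ * M).trace) hP
    simp only [Matrix.mul_add, trace_add, Matrix.mul_zero, trace_zero] at h
    linarith
  have h3 : (Y * Eᵀ * (D * S.Aᵀ)).trace = (Eᵀ * (S.Aᵀ * Y) * D₁).trace := by
    rw [← Matrix.mul_assoc, Matrix.mul_assoc Y, hED, ← Matrix.mul_assoc, trace_mul_comm,
      ← Matrix.mul_assoc, trace_mul_comm]
    simp only [Matrix.mul_assoc]
  have h4 : (Eᵀ * (S.Aᵀ * Y) * D₁).trace =
      -(Eᵀ * (Y * S₁.A) * D₁).trace - (S₁.Cᵀ * S₁.C * D₁).trace := by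
    have h := congrArg (fun M => (Eᵀ * M * D₁).trace) hY
    have hC : S₁.Cᵀ = Eᵀ * S.Cᵀ := by simp [hS₁, LTISystem.project, E]
    rw [hC, Matrix.mul_assoc Eᵀ S.Cᵀ]
    simp only [Matrix.mul_add, Matrix.add_mul, trace_add, Matrix.mul_zero, Matrix.zero_mul,
      trace_zero] at h
    linarith
  -- both Gramians of the leading subsystem are `D₁`
  have h5 : (S₁.Cᵀ * S₁.C * D₁).trace = (S₁.B * S₁.Bᵀ * D₁).trace := by
    have hb := congrArg (fun M => (M * D₁).trace) hP₁
    have hc := congrArg (fun M => (M * D₁).trace) hQ₁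
    simp only [Matrix.add_mul, trace_add, Matrix.zero_mul, trace_zero] at hb hc
    have e1 : (S₁.A * D₁ * D₁).trace = (D₁ * S₁.A * D₁).trace := by
      rw [trace_mul_comm, Matrix.mul_assoc]
    have e2 : (D₁ * S₁.Aᵀ * D₁).trace = (S₁.Aᵀ * D₁ * D₁).trace := by
      rw [trace_mul_comm, ← Matrix.mul_assoc, trace_mul_comm, ← Matrix.mul_assoc]
    have e3 : (S₁.A * D₁ * D₁).trace = (S₁.Aᵀ * D₁ * D₁).trace := by
      rw [← trace_transpose, transpose_mul, transpose_mul, ← Matrix.mul_assoc, trace_mul_comm,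
        hD₁, diagonal_transpose, ← Matrix.mul_assoc]
    linarith
  have h6 : (S.Bᵀ * Y * S₁.B).trace = (Y * Eᵀ * (S.B * S.Bᵀ)).trace := by
    rw [Matrix.mul_assoc, trace_mul_comm]
    simp only [hS₁, LTISystem.project, Matrix.mul_assoc, E]
  have h7 : (S.Bᵀ * D * S.B).trace = (S.B * S.Bᵀ * D).trace := by
    rw [trace_mul_comm, ← Matrix.mul_assoc]
  have h8 : (S₁.Bᵀ * D₁ * S₁.B).trace = (S₁.B * S₁.Bᵀ * D₁).trace := by
    rw [trace_mul_comm, ← Matrix.mul_assoc]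
  simp only [Matrix.add_mul, trace_add, Matrix.smul_mul, trace_smul, smul_eq_mul,
    Matrix.mul_assoc] at h1 h2 h3 h4 h5 h6 h7 h8
  rw [errorGramian]
  simp only [trace_add, trace_sub, trace_smul, smul_eq_mul, Matrix.mul_assoc]
  simp only [D₁, hS₁, D, E] at *
  linarith

end InitialState

/-! ### Balancing transformations -/

section Balancing

variable {n m p r : ℕ}

/-- The mutually inverse matrices `T` and `T'` (of the change of coordinates `x = T x'`) balance the
system `S`, with Hankel singular values `σ`: the matrices `T Σ Tᵀ` and `T'ᵀ Σ T'` obtained by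
transforming `Σ = diag(σ)` back solve the two Lyapunov equations of `S`. -/
structure IsBalancing (S : LTISystem n m p) (T T' : Matrix (Fin n) (Fin n) ℝ) (σ : Fin n → ℝ) :
    Prop where
  inv_mul : T' * T = 1
  pos : ∀ i, 0 < σ i
  reach : S.A * (T * diagonal σ * Tᵀ) + T * diagonal σ * Tᵀ * S.Aᵀ + S.B * S.Bᵀ = 0
  obs : S.Aᵀ * (T'ᵀ * diagonal σ * T') + T'ᵀ * diagonal σ * T' * S.A + S.Cᵀ * S.C = 0

variable {S : LTISystem n m p} {T T' R R' : Matrix (Fin n) (Fin n) ℝ} {σ : Fin n → ℝ}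

namespace IsBalancing

theorem mul_inv (h : IsBalancing S T T' σ) : T * T' = 1 := mul_eq_one_comm.1 h.inv_mul

theorem transpose_mul_transpose (h : IsBalancing S T T' σ) : Tᵀ * T'ᵀ = 1 := by
  rw [← transpose_mul, h.inv_mul, transpose_one]

theorem project_reach (h : IsBalancing S T T' σ) :
    (S.project T T'ᵀ).A * diagonal σ + diagonal σ * (S.project T T'ᵀ).Aᵀ +
      (S.project T T'ᵀ).B * (S.project T T'ᵀ).Bᵀ = 0 := by
  have h1 := congrArg (fun M => T' * M * T'ᵀ) h.reach
  simp only [Matrix.mul_add, Matrix.add_mul, Matrix.mul_zero, Matrix.zero_mul] at h1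
  rw [← h1]
  simp only [LTISystem.project, transpose_mul, transpose_transpose, Matrix.mul_assoc,
    h.transpose_mul_transpose, Matrix.mul_one]
  simp only [← Matrix.mul_assoc, h.inv_mul, Matrix.one_mul]

theorem project_obs (h : IsBalancing S T T' σ) :
    (S.project T T'ᵀ).Aᵀ * diagonal σ + diagonal σ * (S.project T T'ᵀ).A +
      (S.project T T'ᵀ).Cᵀ * (S.project T T'ᵀ).C = 0 := by
  have h1 := congrArg (fun M => Tᵀ * M * T) h.obs
  simp only [Matrix.mul_add, Matrix.add_mul, Matrix.mul_zero, Matrix.zero_mul] at h1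
  rw [← h1]
  simp only [LTISystem.project, transpose_mul, transpose_transpose, Matrix.mul_assoc,
    h.inv_mul, Matrix.mul_one]
  simp only [← Matrix.mul_assoc, h.transpose_mul_transpose, Matrix.one_mul]

end IsBalancing

/-- The square-root method yields the leading columns of a balancing transformation. -/
theorem exists_isBalancing_of_isBalancedTruncation {hr : r ≤ n} {V W : Matrix (Fin n) (Fin r) ℝ}
    (h : S.IsBalancedTruncation hr σ V W) :
    ∃ T T', IsBalancing S T T' σ ∧ V = T * incl hr ∧ W = T'ᵀ * incl hr := by
  obtain ⟨P, Q, U, L, Z, Y, ⟨hP, hPeq⟩, ⟨hQ, hQeq⟩, hU, hL, hZ, hY, hσ, -, hsvd, -, hV, hW⟩ := h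
  have hZ1 : Z * Zᵀ = 1 := (mem_orthogonalGroup_iff (Fin n) ℝ).1 hZ
  have hZ2 : Zᵀ * Z = 1 := (mem_orthogonalGroup_iff' (Fin n) ℝ).1 hZ
  have hY1 : Y * Yᵀ = 1 := (mem_orthogonalGroup_iff (Fin n) ℝ).1 hY
  have hY2 : Yᵀ * Y = 1 := (mem_orthogonalGroup_iff' (Fin n) ℝ).1 hY
  -- the Gramians are nonsingular, so no Hankel singular value vanishes
  have hdet : (diagonal σ).det ≠ 0 := by
    intro h0
    have h1 : (Uᵀ * L).det = 0 := by rw [hsvd, det_mul, det_mul, h0]; ring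
    rw [det_mul, det_transpose] at h1
    rcases mul_eq_zero.1 h1 with h2 | h2
    · exact hP.det_pos.ne' (by rw [hU, det_mul, h2, zero_mul])
    · exact hQ.det_pos.ne' (by rw [hL, det_mul, h2, zero_mul])
  have hpos (i : Fin n) : 0 < σ i := by
    refine lt_of_le_of_ne (hσ i) fun h0 => hdet ?_
    rw [det_diagonal]
    exact Finset.prod_eq_zero (Finset.mem_univ i) h0.symm
  set s : Fin n → ℝ := fun i => (Real.sqrt (σ i))⁻¹ with hs
  have hss : diagonal s * diagonal σ * diagonal s = 1 := by
    rw [diagonal_mul_diagonal, diagonal_mul_diagonal, ← diagonal_one]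
    congr 1
    ext i
    have h1 := Real.sq_sqrt (hσ i)
    have h2 := (Real.sqrt_pos.2 (hpos i)).ne'
    simp only [hs]
    field_simp
    exact h1.symm
  have hLU : Lᵀ * U = Y * diagonal σ * Zᵀ := by
    have := congrArg transpose hsvd
    simpa [Matrix.mul_assoc] using this
  refine ⟨U * Z * diagonal s, diagonal s * Yᵀ * Lᵀ, ⟨?_, hpos, ?_, ?_⟩, ?_, ?_⟩
  · calc diagonal s * Yᵀ * Lᵀ * (U * Z * diagonal s)
        = diagonal s * Yᵀ * (Lᵀ * U) * Z * diagonal s := by simp only [Matrix.mul_assoc]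
      _ = diagonal s * (Yᵀ * Y) * diagonal σ * (Zᵀ * Z) * diagonal s := by
          rw [hLU]; simp only [Matrix.mul_assoc]
      _ = 1 := by rw [hY2, hZ2, Matrix.mul_one, Matrix.mul_one, hss]
  · have h1 : U * Z * diagonal s * diagonal σ * (U * Z * diagonal s)ᵀ = P := by
      calc _ = U * Z * (diagonal s * diagonal σ * diagonal s) * Zᵀ * Uᵀ := by
            simp only [transpose_mul, diagonal_transpose, Matrix.mul_assoc]
        _ = U * (Z * Zᵀ) * Uᵀ := by rw [hss]; simp only [Matrix.mul_assoc, Matrix.mul_one]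
        _ = P := by rw [hZ1, Matrix.mul_one, hU]
    rw [h1]
    exact hPeq
  · have h1 : (diagonal s * Yᵀ * Lᵀ)ᵀ * diagonal σ * (diagonal s * Yᵀ * Lᵀ) = Q := by
      calc _ = L * Y * (diagonal s * diagonal σ * diagonal s) * Yᵀ * Lᵀ := by
            simp only [transpose_mul, diagonal_transpose, transpose_transpose, Matrix.mul_assoc]
        _ = L * (Y * Yᵀ) * Lᵀ := by rw [hss]; simp only [Matrix.mul_assoc, Matrix.mul_one]
        _ = Q := by rw [hY1, Matrix.mul_one, hL]
    rw [h1]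
    exact hQeq
  · rw [hV, ← mul_incl hr, Matrix.mul_assoc (U * Z), diagonal_mul_incl]
    simp only [Matrix.mul_assoc, hs]
  · rw [hW, ← mul_incl hr, transpose_mul, transpose_mul, diagonal_transpose, transpose_transpose,
      transpose_transpose]
    simp only [Matrix.mul_assoc, diagonal_mul_incl, hs]

theorem exists_isBalancing_of_isBalancedRealization {bal : LTISystem n m p}
    (h : S.IsBalancedRealization bal σ) :
    ∃ R R', IsBalancing S R R' σ ∧ bal = S.project R R'ᵀ := by
  obtain ⟨⟨R, hR, hA, hB, hC⟩, -, ⟨hpd, hreach⟩, -, hobs⟩ := h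
  have h1 : R⁻¹ * R = 1 := nonsing_inv_mul R hR
  have h2 : R * R⁻¹ = 1 := mul_nonsing_inv R hR
  have h3 : Rᵀ * (R⁻¹)ᵀ = 1 := by rw [← transpose_mul, h1, transpose_one]
  have h4 : (R⁻¹)ᵀ * Rᵀ = 1 := by rw [← transpose_mul, h2, transpose_one]
  have hSA : S.A = R * bal.A * R⁻¹ := by
    rw [hA]
    calc S.A = (R * R⁻¹) * S.A * (R * R⁻¹) := by rw [h2, Matrix.one_mul, Matrix.mul_one]
      _ = _ := by simp only [Matrix.mul_assoc]
  have hSB : S.B = R * bal.B := by rw [hB, ← Matrix.mul_assoc, h2, Matrix.one_mul]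
  have hSC : S.C = bal.C * R⁻¹ := by rw [hC, Matrix.mul_assoc, h2, Matrix.mul_one]
  refine ⟨R, R⁻¹, ⟨h1, posDef_diagonal_iff.1 hpd, ?_, ?_⟩, ?_⟩
  · have h := congrArg (fun M => R * M * Rᵀ) hreach
    simp only [Matrix.mul_add, Matrix.add_mul, Matrix.mul_zero, Matrix.zero_mul] at h
    rw [← h, hSA, hSB]
    congr 1
    · congr 1
      · calc _ = R * bal.A * (R⁻¹ * R) * diagonal σ * Rᵀ := by simp only [Matrix.mul_assoc]
          _ = _ := by rw [h1, Matrix.mul_one]; simp only [Matrix.mul_assoc]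
      · calc _ = R * diagonal σ * (Rᵀ * (R⁻¹)ᵀ) * bal.Aᵀ * Rᵀ := by
              simp only [transpose_mul, Matrix.mul_assoc]
          _ = _ := by rw [h3, Matrix.mul_one]; simp only [Matrix.mul_assoc]
    · simp only [transpose_mul, Matrix.mul_assoc]
  · have h := congrArg (fun M => (R⁻¹)ᵀ * M * R⁻¹) hobs
    simp only [Matrix.mul_add, Matrix.add_mul, Matrix.mul_zero, Matrix.zero_mul] at h
    rw [← h, hSA, hSC]
    congr 1
    · congr 1
      · calc _ = (R⁻¹)ᵀ * bal.Aᵀ * (Rᵀ * (R⁻¹)ᵀ) * diagonal σ * R⁻¹ := by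
              simp only [transpose_mul, Matrix.mul_assoc]
          _ = _ := by rw [h3, Matrix.mul_one]; simp only [Matrix.mul_assoc]
      · calc _ = (R⁻¹)ᵀ * diagonal σ * (R⁻¹ * R) * bal.A * R⁻¹ := by simp only [Matrix.mul_assoc]
          _ = _ := by rw [h1, Matrix.mul_one]; simp only [Matrix.mul_assoc]
    · simp only [transpose_mul, Matrix.mul_assoc]
  · cases bal
    simp only [LTISystem.project, transpose_transpose] at *
    rw [hA, hB, hC]

/-- For a stable matrix the homogeneous Lyapunov equation has only the trivial solution, because
`xᵀ X y` is constant along decaying solutions. -/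
theorem lyapunov_unique {A X : Matrix (Fin n) (Fin n) ℝ}
    (hA : ∀ μ ∈ spectrum ℂ (A.map (algebraMap ℝ ℂ)), μ.re < 0) (h : Aᵀ * X + X * A = 0) :
    X = 0 := by
  have hquad (a b : Fin n → ℝ) : a ⬝ᵥ (X *ᵥ b) = 0 := by
    obtain ⟨x, hx, hx0⟩ := exists_decaying_solution A hA a
    obtain ⟨y, hy, hy0⟩ := exists_decaying_solution A hA b
    have hconst (t : ℝ) (ht : 0 ≤ t) : x t ⬝ᵥ (X *ᵥ y t) = a ⬝ᵥ (X *ᵥ b) := by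
      have h1 := (hx.dotProduct (hy.mulVec X)).eq_integral t ht
      have h2 (s : ℝ) : (A *ᵥ x s) ⬝ᵥ (X *ᵥ y s) + x s ⬝ᵥ (X *ᵥ (A *ᵥ y s)) = 0 := by
        have h3 := sylvester_bilinear (C := (0 : Matrix (Fin 0) (Fin n) ℝ))
          (C' := (0 : Matrix (Fin 0) (Fin n) ℝ)) (by simpa using h) (x s) (y s)
        simpa using h3
      simp only [h2, intervalIntegral.integral_zero, add_zero] at h1
      exact h1
    have hc : Continuous fun q : (Fin n → ℝ) × (Fin n → ℝ) => q.1 ⬝ᵥ (X *ᵥ q.2) := by fun_prop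
    have hlim := (hc.tendsto (0, 0)).comp (hx0.prodMk_nhds hy0)
    simp only [zero_dotProduct] at hlim
    refine tendsto_nhds_unique (tendsto_const_nhds.congr' ?_) hlim
    filter_upwards [eventually_ge_atTop 0] with t ht
    exact (hconst t ht).symm
  ext i j
  simpa using hquad (Pi.single i 1) (Pi.single j 1)

theorem spectrum_transpose_map (A : Matrix (Fin n) (Fin n) ℝ) :
    spectrum ℂ (Aᵀ.map (algebraMap ℝ ℂ)) = spectrum ℂ (A.map (algebraMap ℝ ℂ)) := by
  ext μ
  rw [mem_spectrum_iff_isRoot_charpoly, mem_spectrum_iff_isRoot_charpoly, transpose_map,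
    charpoly_transpose]

/-- Two balancing transformations of a stable system with the same Hankel singular values differ by
a matrix `K` with `K Σ Kᵀ = Σ = Kᵀ Σ K`.  It commutes with `Σ²`, so it does not couple states with
different singular values, and hence leaves a truncation at a gap invariant. -/
theorem IsBalancing.apply_eq_zero (hA : S.IsStable) (h₁ : IsBalancing S T T' σ)
    (h₂ : IsBalancing S R R' σ) {i j : Fin n} (hij : σ i ≠ σ j) : (R' * T) i j = 0 := by
  have hreach : T * diagonal σ * Tᵀ = R * diagonal σ * Rᵀ := by
    refine sub_eq_zero.1 (lyapunov_unique (A := S.Aᵀ) ?_ ?_)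
    · rw [spectrum_transpose_map]
      exact hA
    · have h := (h₁.reach.trans h₂.reach.symm)
      have h' := sub_eq_zero.2 (add_right_cancel h)
      rw [transpose_transpose, Matrix.mul_sub, Matrix.sub_mul, ← h']
      abel
  have hobs : T'ᵀ * diagonal σ * T' = R'ᵀ * diagonal σ * R' := by
    refine sub_eq_zero.1 (lyapunov_unique (A := S.A) hA ?_)
    have h := (h₁.obs.trans h₂.obs.symm)
    have h' := sub_eq_zero.2 (add_right_cancel h)
    rw [Matrix.mul_sub, Matrix.sub_mul, ← h']
    abel
  set K := R' * T with hK
  have hK1 : K * diagonal σ * Kᵀ = diagonal σ := by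
    calc K * diagonal σ * Kᵀ = R' * (T * diagonal σ * Tᵀ) * R'ᵀ := by
          simp only [hK, transpose_mul, Matrix.mul_assoc]
      _ = (R' * R) * diagonal σ * (Rᵀ * R'ᵀ) := by rw [hreach]; simp only [Matrix.mul_assoc]
      _ = diagonal σ := by
          rw [h₂.inv_mul, h₂.transpose_mul_transpose, Matrix.one_mul, Matrix.mul_one]
  have hK2 : Kᵀ * diagonal σ * K = diagonal σ := by
    calc Kᵀ * diagonal σ * K = Tᵀ * (R'ᵀ * diagonal σ * R') * T := by
          simp only [hK, transpose_mul, Matrix.mul_assoc]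
      _ = (Tᵀ * T'ᵀ) * diagonal σ * (T' * T) := by rw [← hobs]; simp only [Matrix.mul_assoc]
      _ = diagonal σ := by
          rw [h₁.inv_mul, h₁.transpose_mul_transpose, Matrix.one_mul, Matrix.mul_one]
  have hcomm : K * diagonal σ * diagonal σ = diagonal σ * (diagonal σ * K) := by
    calc K * diagonal σ * diagonal σ = K * diagonal σ * (Kᵀ * diagonal σ * K) := by rw [hK2]
      _ = (K * diagonal σ * Kᵀ) * (diagonal σ * K) := by simp only [Matrix.mul_assoc]
      _ = _ := by rw [hK1]
  have h := congrFun (congrFun hcomm i) j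
  simp only [mul_diagonal, diagonal_mul] at h
  have h1 : K i j * ((σ j - σ i) * (σ j + σ i)) = 0 := by linear_combination h
  rcases mul_eq_zero.1 h1 with h2 | h2
  · exact h2
  · rcases mul_eq_zero.1 h2 with h3 | h3
    · exact absurd (sub_eq_zero.1 h3).symm hij
    · exact absurd h3 (add_pos (h₁.pos j) (h₁.pos i)).ne'

/-- The matrix `K = R' T` comparing two balancing transformations is block diagonal for a partition
at a gap of the Hankel singular values. -/
theorem IsBalancing.mul_incl_eq (hA : S.IsStable) (h₁ : IsBalancing S T T' σ)
    (h₂ : IsBalancing S R R' σ) (hr : r ≤ n)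
    (hgap : ∀ i j : Fin n, i.val < r → r ≤ j.val → σ j < σ i) :
    R' * T * incl hr = incl hr * ((incl hr)ᵀ * (R' * T) * incl hr) ∧
      (incl hr)ᵀ * (R' * T) = (incl hr)ᵀ * (R' * T) * incl hr * (incl hr)ᵀ := by
  have hz1 {i j : Fin n} (hi : r ≤ i.val) (hj : j.val < r) : (R' * T) i j = 0 :=
    h₁.apply_eq_zero hA h₂ (hgap j i hj hi).ne
  have hz2 {i j : Fin n} (hi : i.val < r) (hj : r ≤ j.val) : (R' * T) i j = 0 :=
    h₁.apply_eq_zero hA h₂ (hgap i j hi hj).ne'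
  constructor
  · rw [← Matrix.mul_assoc, ← Matrix.mul_assoc, incl_mul_transpose]
    ext i j
    rw [mul_incl, mul_incl, submatrix_apply, submatrix_apply, diagonal_mul]
    split_ifs with h
    · simp
    · rw [zero_mul]
      exact hz1 (not_lt.1 h) j.2
  · rw [Matrix.mul_assoc _ (incl hr), incl_mul_transpose]
    ext i j
    rw [mul_diagonal, transpose_incl_mul, submatrix_apply]
    split_ifs with h
    · simp
    · rw [mul_zero]
      exact hz2 i.2 (not_lt.1 h)

end Balancing

/-! ### Transfer to the original coordinates -/

section Transfer

variable {n m p r : ℕ} {S : LTISystem n m p} {T T' R R' : Matrix (Fin n) (Fin n) ℝ} {σ : Fin n → ℝ}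

theorem project_project (hr : r ≤ n) :
    S.project (T * incl hr) (T'ᵀ * incl hr) =
      (S.project T T'ᵀ).project (incl hr) (incl hr) := by
  simp only [LTISystem.project, transpose_mul, transpose_transpose, Matrix.mul_assoc]

theorem IsBalancing.isPrimitive (h : IsBalancing S T T' σ) {x b : ℝ → Fin n → ℝ} {x₀ : Fin n → ℝ}
    (hx : IsPrimitive x (fun t => S.A *ᵥ x t + b t) x₀) :
    IsPrimitive (fun t => T' *ᵥ x t) (fun t => (S.project T T'ᵀ).A *ᵥ (T' *ᵥ x t) + T' *ᵥ b t)
      (T' *ᵥ x₀) := by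
  refine (hx.mulVec T').congr (fun _ _ => rfl) (fun t _ => ?_) rfl
  rw [mulVec_add, mulVec_mulVec, mulVec_mulVec, LTISystem.project, transpose_transpose,
    Matrix.mul_assoc _ T, h.mul_inv, Matrix.mul_one]

theorem IsBalancing.output (h : IsBalancing S T T' σ) (x : Fin n → ℝ) :
    (S.project T T'ᵀ).C *ᵥ (T' *ᵥ x) = S.C *ᵥ x := by
  rw [mulVec_mulVec, LTISystem.project, Matrix.mul_assoc, h.mul_inv, Matrix.mul_one]

/-- The error bound for the response to the input, in arbitrary coordinates. -/
theorem hasL2Bound_input {hr : r ≤ n} {V W : Matrix (Fin n) (Fin r) ℝ}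
    (h : S.IsBalancedTruncation hr σ V W) {u : ℝ → Fin m → ℝ} (hu : MemL2 u)
    {x : ℝ → Fin n → ℝ} (hx : S.IsTrajectory u 0 x) {ξ : ℝ → Fin r → ℝ}
    (hξ : (S.project V W).IsTrajectory u 0 ξ) :
    0 ≤ truncatedSum r σ ∧ HasL2Bound (fun t => S.C *ᵥ x t - (S.project V W).C *ᵥ ξ t)
      (2 * truncatedSum r σ * normL2 u) := by
  obtain ⟨T, T', hT, rfl, rfl⟩ := exists_isBalancing_of_isBalancedTruncation h
  rw [project_project] at hξ ⊢
  have px := hT.isPrimitive hx.isPrimitive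
  have tx : (S.project T T'ᵀ).IsTrajectory u 0 (fun t => T' *ᵥ x t) := by
    have h1 := px.congr (x' := fun t => T' *ᵥ x t)
      (v' := fun t => (S.project T T'ᵀ).A *ᵥ (T' *ᵥ x t) + (S.project T T'ᵀ).B *ᵥ u t) (x₀' := 0)
      (fun _ _ => rfl) (fun t _ => by simp [LTISystem.project, mulVec_mulVec]) (by simp)
    exact ⟨h1.integrable, h1.eq_integral⟩
  have hb := hasL2Bound_project hT.pos hT.project_reach hT.project_obs hu hr tx hξ
  refine ⟨Finset.sum_nonneg fun i _ => (hT.pos i).le, ?_⟩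
  simpa only [hT.output] using hb

/-- The error bound for the response to the initial state, in arbitrary coordinates. -/
theorem hasL2Bound_initialState (hS : S.IsStable) {hr : r ≤ n} {V W : Matrix (Fin n) (Fin r) ℝ}
    (h : S.IsBalancedTruncation hr σ V W) {bal : LTISystem n m p}
    (hbal : S.IsBalancedRealization bal σ) {Y : Matrix (Fin n) (Fin r) ℝ}
    (hY : SolvesSylvester hr bal Y) (z : Fin m → ℝ) {x : ℝ → Fin n → ℝ}
    (hx : IsPrimitive x (fun t => S.A *ᵥ x t) (S.B *ᵥ z)) (hx0 : Tendsto x atTop (𝓝 0))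
    {ξ : ℝ → Fin r → ℝ}
    (hξ : IsPrimitive ξ (fun t => (S.project V W).A *ᵥ ξ t) ((S.project V W).B *ᵥ z)) :
    0 ≤ traceTTheta hr bal σ Y ∧ HasL2Bound (fun t => S.C *ᵥ x t - (S.project V W).C *ᵥ ξ t)
      (Real.sqrt (traceTTheta hr bal σ Y) *
        ‖(WithLp.toLp 2 z : EuclideanSpace ℝ (Fin m))‖) := by
  have hgap : ∀ i j : Fin n, i.val < r → r ≤ j.val → σ j < σ i := by
    obtain ⟨P, Q, U, L, Z, Y, -, -, -, -, -, -, -, -, -, hgap, -⟩ := h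
    exact hgap
  obtain ⟨T, T', hT, rfl, rfl⟩ := exists_isBalancing_of_isBalancedTruncation h
  obtain ⟨R, R', hR, rfl⟩ := exists_isBalancing_of_isBalancedRealization hbal
  set bal := S.project R R'ᵀ with hbaldef
  obtain ⟨hK1, hK2⟩ := hT.mul_incl_eq hS hR hr hgap
  set E := incl hr with hE
  set K₁ := Eᵀ * (R' * T) * E with hK₁
  have hTE : T * E = R * E * K₁ := by
    rw [Matrix.mul_assoc, ← hK1, ← Matrix.mul_assoc, ← Matrix.mul_assoc, hR.mul_inv, Matrix.one_mul]
  have hET : K₁ * (Eᵀ * T') = Eᵀ * R' := by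
    rw [← Matrix.mul_assoc, ← hK2, Matrix.mul_assoc, Matrix.mul_assoc, hT.mul_inv, Matrix.mul_one]
  -- `K₁` takes the reduced model to the truncation of the given balanced realization
  have pη : IsPrimitive (fun t => K₁ *ᵥ ξ t)
      (fun t => (bal.project E E).A *ᵥ (K₁ *ᵥ ξ t)) ((bal.project E E).B *ᵥ z) := by
    refine (hξ.mulVec K₁).congr (fun _ _ => rfl) (fun t _ => ?_) ?_
    · rw [mulVec_mulVec, mulVec_mulVec]
      congr 1
      calc (bal.project E E).A * K₁ = Eᵀ * R' * S.A * (R * E * K₁) := by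
            simp only [hbaldef, LTISystem.project, transpose_transpose, Matrix.mul_assoc]
        _ = K₁ * (Eᵀ * T') * S.A * (T * E) := by rw [hET, hTE]
        _ = _ := by simp only [LTISystem.project, transpose_mul, transpose_transpose,
            Matrix.mul_assoc]
    · rw [mulVec_mulVec]
      congr 1
      calc (bal.project E E).B = Eᵀ * R' * S.B := by
            simp only [hbaldef, LTISystem.project, transpose_transpose, Matrix.mul_assoc]
        _ = K₁ * (Eᵀ * T') * S.B := by rw [hET]
        _ = _ := by simp only [LTISystem.project, transpose_mul, transpose_transpose,
            Matrix.mul_assoc]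
  have hCη (t : ℝ) : (bal.project E E).C *ᵥ (K₁ *ᵥ ξ t) =
      (S.project (T * E) (T'ᵀ * E)).C *ᵥ ξ t := by
    rw [mulVec_mulVec]
    congr 1
    simp only [hbaldef, LTISystem.project, Matrix.mul_assoc]
    rw [hTE]
    simp only [Matrix.mul_assoc]
  have decay (z : Fin m → ℝ) {x : ℝ → Fin n → ℝ}
      (hx : IsPrimitive x (fun t => S.A *ᵥ x t) (S.B *ᵥ z)) (hx0 : Tendsto x atTop (𝓝 0)) :
      IsPrimitive (fun t => R' *ᵥ x t) (fun t => bal.A *ᵥ (R' *ᵥ x t)) (bal.B *ᵥ z) ∧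
        Tendsto (fun t => R' *ᵥ x t) atTop (𝓝 0) := by
    constructor
    · have h1 := hR.isPrimitive (b := fun _ => 0) (hx.congr (fun _ _ => rfl) (by simp) rfl)
      exact h1.congr (fun _ _ => rfl) (by simp [hbaldef])
        (by simp [hbaldef, LTISystem.project, mulVec_mulVec])
    · have hc : Continuous fun a : Fin n → ℝ => R' *ᵥ a := by fun_prop
      have h1 := (hc.tendsto 0).comp hx0
      simp only [mulVec_zero] at h1
      exact h1
  have hnonneg (z : Fin m → ℝ) : 0 ≤ z ⬝ᵥ (errorGramian hr bal σ Y *ᵥ z) := by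
    obtain ⟨x, hx, hx0⟩ := exists_decaying_solution S.A hS (S.B *ᵥ z)
    obtain ⟨η, hη⟩ := exists_homogeneous_solution (bal.project E E).A ((bal.project E E).B *ᵥ z)
    obtain ⟨d1, d2⟩ := decay z hx hx0
    simpa using energy_le_errorGramian hR.pos hR.project_obs hr hY z d1 d2 hη le_rfl
  have htr := trace_errorGramian hr hR.project_reach hR.project_obs hY
  obtain ⟨htr0, hle⟩ := dotProduct_mulVec_le_trace hnonneg z
  rw [htr] at htr0 hle
  refine ⟨htr0, ?_⟩
  obtain ⟨d1, d2⟩ := decay z hx hx0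
  refine HasL2Bound.congr (f := fun t => bal.C *ᵥ (R' *ᵥ x t) -
    (bal.project E E).C *ᵥ (K₁ *ᵥ ξ t)) ?_ (fun t _ => ?_)
  · refine HasL2Bound.of_energy ((d1.mulVec bal.C).sub (pη.mulVec _)).continuousOn_Ici
      (mul_nonneg (Real.sqrt_nonneg _) (norm_nonneg _)) fun T hT => ?_
    rw [mul_pow, Real.sq_sqrt htr0, norm_toLp_sq]
    exact (energy_le_errorGramian hR.pos hR.project_obs hr hY z d1 d2 pη hT).trans hle
  · rw [hCη, hR.output]

end Transfer

end BalancedTruncation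

theorem theorem3p2 {n m p n₀ : ℕ}
    (A : Matrix (Fin n) (Fin n) ℝ) (B : Matrix (Fin n) (Fin m) ℝ) (C : Matrix (Fin p) (Fin n) ℝ)
    (X₀ : Matrix (Fin n) (Fin n₀) ℝ)
    -- standing assumptions on the full model
    (hstable : (LTISystem.mk A B C).IsStable)
    (hcontr : (LTISystem.mk A B C).IsControllable)
    (hobs : (LTISystem.mk A B C).IsObservable)
    -- balanced truncation of the input-to-output map to order `ru`
    {ru : ℕ} (hru : ru ≤ n) (σ : Fin n → ℝ) (Vu Wu : Matrix (Fin n) (Fin ru) ℝ)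
    (hu_bt : (LTISystem.mk A B C).IsBalancedTruncation hru σ Vu Wu)
    -- balanced truncation of the initial-condition-to-output map to order `rx`
    {rx : ℕ} (hrx : rx ≤ n) (θ : Fin n → ℝ) (Vx Wx : Matrix (Fin n) (Fin rx) ℝ)
    (hx_bt : (LTISystem.mk A X₀ C).IsBalancedTruncation hrx θ Vx Wx)
    -- a fully balanced realization of that map and the solution of the Sylvester equation
    (bal : LTISystem n n₀ p)
    (hbal : (LTISystem.mk A X₀ C).IsBalancedRealization bal θ)
    (Y : Matrix (Fin n) (Fin rx) ℝ) (hY : SolvesSylvester hrx bal Y)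
    -- input and initial condition, and the output of the full model
    (u : ℝ → Fin m → ℝ) (hu : MemL2 u) (x₀ : Fin n → ℝ) (z₀ : Fin n₀ → ℝ)
    (hx₀ : x₀ = X₀.mulVec z₀)
    (y : ℝ → Fin p → ℝ) (hy : (LTISystem.mk A B C).IsOutput u x₀ y)
    -- the outputs of the two reduced models: input `u` with zero initial state,
    -- and zero input with initial state `(Wxᵀ X₀) z₀`
    (yu yx : ℝ → Fin p → ℝ)
    (hyu : ((LTISystem.mk A B C).project Vu Wu).IsOutput u 0 yu)
    (hyx : ((LTISystem.mk A X₀ C).project Vx Wx).IsOutput (fun _ => 0)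
      ((Wx.transpose * X₀).mulVec z₀) yx) :
    0 ≤ traceTTheta hrx bal θ Y ∧
    MemL2 (fun t => y t - (yu t + yx t)) ∧
    normL2 (fun t => y t - (yu t + yx t)) ≤
      (2 * truncatedSum ru σ) * normL2 u +
        Real.sqrt (traceTTheta hrx bal θ Y) * ‖(WithLp.toLp 2 z₀ : EuclideanSpace ℝ (Fin n₀))‖ := by
  obtain ⟨x, hx, hy'⟩ := hy
  obtain ⟨ξu, hξu, hyu'⟩ := hyu
  obtain ⟨ξx, hξx, hyx'⟩ := hyx
  obtain ⟨w, hw, hw0⟩ := BalancedTruncation.exists_decaying_solution A hstable x₀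
  -- superposition: `w` is the response to the initial state, `x - w` the response to the input
  have hxw : (LTISystem.mk A B C).IsTrajectory u 0 (fun t => x t - w t) := by
    have h := (hx.isPrimitive.sub hw).congr (x' := fun t => x t - w t)
      (v' := fun t => A.mulVec (x t - w t) + B.mulVec (u t)) (x₀' := 0) (fun _ _ => rfl)
      (fun t _ => by rw [Matrix.mulVec_sub]; abel) (by simp)
    exact ⟨h.integrable, h.eq_integral⟩
  obtain ⟨hs, hbu⟩ := BalancedTruncation.hasL2Bound_input hu_bt hu hxw hξu
  have hstable' : (LTISystem.mk A X₀ C).IsStable := hstable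
  obtain ⟨htr, hbx⟩ := BalancedTruncation.hasL2Bound_initialState hstable' hx_bt hbal hY z₀
    (hx₀ ▸ hw) hw0
    (hξx.isPrimitive.congr (fun _ _ => rfl) (by simp) rfl)
  have hcu : 0 ≤ 2 * truncatedSum ru σ * normL2 u :=
    mul_nonneg (mul_nonneg zero_le_two hs) (BalancedTruncation.normL2_nonneg u)
  have hcx : 0 ≤ Real.sqrt (traceTTheta hrx bal θ Y) *
      ‖(WithLp.toLp 2 z₀ : EuclideanSpace ℝ (Fin n₀))‖ :=
    mul_nonneg (Real.sqrt_nonneg _) (norm_nonneg _)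
  have hb := (hbu.add hbx hcu hcx).congr (g := fun t => y t - (yu t + yx t)) (fun t ht => by
    rw [hy' t ht, hyu' t ht, hyx' t ht, Matrix.mulVec_sub]
    abel)
  exact ⟨htr, hb.memL2, hb.normL2_le (add_nonneg hcu hcx)⟩
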